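/- Let $R$ be a commutative ring and let $(\mathcal X,\diamond,\mathbf 1)$ be an essentially small symmetric monoidal category enriched in $R$-modules (so $\diamond$ is $R$-bilinear). Let $\mathcal F$ be the category of $R$-linear functors $\mathcal X\to R\text{-Mod}$, with its symmetric monoidal structure $\otimes$ (Day convolution). Let $A$ be a commutative monoid in $\mathcal F$ that is tensor idempotent, i.e. its multiplication $\mu_A:A\otimes A\to A$ is an isomorphism in $\mathcal F$. Let $n\ge 0$ and let $A_n=A[t_1,\dots,t_n]$ be the monoid of polynomials, $A_n(x)=A(x)[t_1,\dots,t_n]$. Call an $A_n$-module $P$ *$\mathcal F$-projective* if every morphism $P\to N$ of $A_n$-modules lifts along every morphism $L\to N$ of $A_n$-modules that is a split epimorphism in $\mathcal F$. Then every $A_n$-module $M$ admits a finite $\mathcal F$-split resolution of length $n$ $$0\to L_n\to L_{n-1}\to\cdots\to L_1\to L_0\to M\to 0$$ by $\mathcal F$-projective $A_n$-modules $L_0,\dots,L_n$; that is, this complex is exact in the category of $A_n$-modules, and as a complex in $\mathcal F$ it is split (there are maps $s$ of degree $1$ with $dsd=d$). More precisely, let $C=A[u_1,\dots,u_n,v_1,\dots,v_n]$,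 considered as an $A_n$-bimodule with $t_i$ acting on the left by $u_i$ and on the right by $v_i$, let $\alpha_i=u_i-v_i$, and let $K_C(\alpha)$ be the Koszul complex of $C$, with $K_p=\bigoplus_{S\subseteq\{1,\dots,n\},\,|S|=p}C$ and differential given on the summand of $S=\{i_1<\dots<i_p\}$ by $\sum_{k}(-1)^{k+1}\alpha_{i_k}$ with values in the summands of $S\setminus\{i_k\}$. Then the resolution can be taken to be $K_C(\alpha)\otimes_{A_n}M$, with augmentation $C\otimes_{A_n}M\to A_n\otimes_{A_n}M\cong M$ induced by the morphism of monoids $C\to A_n$ that is the identity on $A$ and maps $u_i$ and $v_i$ to $t_i$. -/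

import Mathlib

open CategoryTheory MonoidalCategory

universe w v u

noncomputable section

/-- The category `𝓕` of `R`-linear functors from `X` to `R`-modules. -/
abbrev LinFun (R : Type w) [CommRing R] (X : Type u) [Category.{v} X] [Preadditive X]
    [Linear R X] :=
  ObjectProperty.FullSubcategory
    (fun F : X ⥤ ModuleCat.{w} R => F.Additive ∧ F.Linear R)

namespace LinFun

variable {R : Type w} [CommRing R] {X : Type u} [Category.{v} X] [Preadditive X] [Linear R X]

/-- The value `F(x)`. -/
abbrev val (F : LinFun R X) (x : X) : Type w := F.obj.obj x

/-- The linear map `F(f) : F(x) → F(y)`. -/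
def act (F : LinFun R X) {x y : X} (f : x ⟶ y) : F.val x →ₗ[R] F.val y := (F.obj.map f).hom

@[simp] lemma act_id (F : LinFun R X) (x : X) (a : F.val x) : F.act (𝟙 x) a = a := by
  simp [act]

lemma act_comp (F : LinFun R X) {x y z : X} (f : x ⟶ y) (g : y ⟶ z) (a : F.val x) :
    F.act (f ≫ g) a = F.act g (F.act f a) := by
  simp [act]

lemma act_add (F : LinFun R X) {x y : X} (f g : x ⟶ y) : F.act (f + g) = F.act f + F.act g := by
  have := F.property.1
  simp [act]

lemma act_smul (F : LinFun R X) {x y : X} (r : R) (f : x ⟶ y) :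
    F.act (r • f) = r • F.act f := by
  have := F.property.2
  simp [act]

/-- The component at `x` of a morphism of `𝓕`. -/
def comp {F G : LinFun R X} (φ : F ⟶ G) (x : X) : F.val x →ₗ[R] G.val x := (φ.hom.app x).hom

lemma comp_act {F G : LinFun R X} (φ : F ⟶ G) {x y : X} (f : x ⟶ y) (a : F.val x) :
    comp φ y (F.act f a) = G.act f (comp φ x a) :=
  congrArg (fun h => h.hom a) (φ.hom.naturality f)

@[simp] lemma comp_id (F : LinFun R X) (x : X) (a : F.val x) : comp (𝟙 F) x a = a := rfl

@[simp] lemma comp_comp {F G H : LinFun R X} (φ : F ⟶ G) (ψ : G ⟶ H) (x : X) (a : F.val x) :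
    comp (φ ≫ ψ) x a = comp ψ x (comp φ x a) := rfl

@[simp] lemma comp_add {F G : LinFun R X} (φ ψ : F ⟶ G) (x : X) (a : F.val x) :
    comp (φ + ψ) x a = comp φ x a + comp ψ x a := rfl

@[simp] lemma comp_neg {F G : LinFun R X} (φ : F ⟶ G) (x : X) (a : F.val x) :
    comp (-φ) x a = - comp φ x a := rfl

@[simp] lemma comp_zero {F G : LinFun R X} (x : X) (a : F.val x) :
    comp (0 : F ⟶ G) x a = 0 := rfl

lemma hom_ext {F G : LinFun R X} {φ ψ : F ⟶ G} (h : ∀ x a, comp φ x a = comp ψ x a) :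
    φ = ψ := by
  apply ObjectProperty.hom_ext
  ext x a
  exact h x a

/-- Constructor for objects of `𝓕`. -/
abbrev of (V : X → Type w) [∀ x, AddCommGroup (V x)] [∀ x, Module R (V x)]
    (m : ∀ {x y : X}, (x ⟶ y) →ₗ[R] V x →ₗ[R] V y)
    (m_id : ∀ x (a : V x), m (𝟙 x) a = a)
    (m_comp : ∀ {x y z : X} (f : x ⟶ y) (g : y ⟶ z) (a : V x), m (f ≫ g) a = m g (m f a)) :
    LinFun R X where
  obj :=
    { obj := fun x => ModuleCat.of R (V x)
      map := fun f => ModuleCat.ofHom (m f)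
      map_id := fun x => by ext a; exact m_id x a
      map_comp := fun f g => by ext a; exact m_comp f g a }
  property := ⟨⟨fun {x y f g} => by ext a; simp⟩, ⟨fun {x y} f r => by ext a; simp⟩⟩

/-- Constructor for morphisms of `𝓕`. -/
def homMk {F G : LinFun R X} (φ : ∀ x, F.val x →ₗ[R] G.val x)
    (h : ∀ {x y : X} (f : x ⟶ y) (a : F.val x), φ y (F.act f a) = G.act f (φ x a)) : F ⟶ G :=
  ObjectProperty.homMk
    { app := fun x => ModuleCat.ofHom (φ x)
      naturality := fun x y f => by ext a; exact h f a }

@[simp] lemma comp_homMk {F G : LinFun R X} (φ : ∀ x, F.val x →ₗ[R] G.val x)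
    (h : ∀ {x y : X} (f : x ⟶ y) (a : F.val x), φ y (F.act f a) = G.act f (φ x a)) (x : X) :
    comp (homMk φ h) x = φ x := rfl

/-- For a bilinear map `μ : P × Q → F(x)`, the trilinear map `(f, p, q) ↦ F(f)(μ(p, q))`. -/
def actMul (F : LinFun R X) {P Q : Type*} [AddCommGroup P] [Module R P] [AddCommGroup Q]
    [Module R Q] {x z : X} (μ : P →ₗ[R] Q →ₗ[R] F.val x) :
    (x ⟶ z) →ₗ[R] P →ₗ[R] Q →ₗ[R] F.val z where
  toFun f := μ.compr₂ (F.act f)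
  map_add' f g := by ext; simp [act_add]
  map_smul' r f := by ext; simp [act_smul]

@[simp] lemma actMul_apply (F : LinFun R X) {P Q : Type*} [AddCommGroup P] [Module R P]
    [AddCommGroup Q] [Module R Q] {x z : X} (μ : P →ₗ[R] Q →ₗ[R] F.val x) (f : x ⟶ z) (p : P)
    (q : Q) : F.actMul μ f p q = F.act f (μ p q) := rfl

end LinFun

/-- A monoid in `𝓕` (for the tensor product of `𝓕`, see `dayTensor` below), given by its
products `A(x) × A(y) → A(x ⊗ y)`, `(a, b) ↦ a × b`, and its identity element in `A(𝟙)`. -/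
structure FMonoid (R : Type w) [CommRing R] (X : Type u) [Category.{v} X] [Preadditive X]
    [Linear R X] [MonoidalCategory X] where
  toFun : LinFun R X
  mul (x y : X) : toFun.val x →ₗ[R] toFun.val y →ₗ[R] toFun.val (x ⊗ y)
  one : toFun.val (𝟙_ X)
  mul_natural {x x' y y' : X} (f : x ⟶ x') (g : y ⟶ y') (a : toFun.val x) (b : toFun.val y) :
    mul x' y' (toFun.act f a) (toFun.act g b) = toFun.act (f ⊗ₘ g) (mul x y a b)
  mul_assoc {x y z : X} (a : toFun.val x) (b : toFun.val y) (c : toFun.val z) :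
    toFun.act (α_ x y z).hom (mul (x ⊗ y) z (mul x y a b) c) = mul x (y ⊗ z) a (mul y z b c)
  one_mul {x : X} (a : toFun.val x) : toFun.act (λ_ x).hom (mul (𝟙_ X) x one a) = a
  mul_one {x : X} (a : toFun.val x) : toFun.act (ρ_ x).hom (mul x (𝟙_ X) a one) = a

section

variable {R : Type w} [CommRing R] {X : Type u} [Category.{v} X] [Preadditive X] [Linear R X]
  [MonoidalCategory X]

/-- Commutative monoids in `𝓕`. -/
class FMonoid.IsComm [BraidedCategory X] (A : FMonoid R X) : Prop where
  comm {x y : X} (a : A.toFun.val x) (b : A.toFun.val y) :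
    A.toFun.act (β_ x y).hom (A.mul x y a b) = A.mul y x b a

/-- Morphisms of monoids in `𝓕`. -/
structure FMonoid.Hom (A B : FMonoid R X) where
  hom : A.toFun ⟶ B.toFun
  map_mul {x y : X} (a : A.toFun.val x) (b : A.toFun.val y) :
    LinFun.comp hom (x ⊗ y) (A.mul x y a b) =
      B.mul x y (LinFun.comp hom x a) (LinFun.comp hom y b)
  map_one : LinFun.comp hom (𝟙_ X) A.one = B.one

/-- (Left) modules over a monoid `A` in `𝓕`, given by `A(x) × M(y) → M(x ⊗ y)`. -/
structure FMod (A : FMonoid R X) where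
  toFun : LinFun R X
  smul (x y : X) : A.toFun.val x →ₗ[R] toFun.val y →ₗ[R] toFun.val (x ⊗ y)
  smul_natural {x x' y y' : X} (f : x ⟶ x') (g : y ⟶ y') (a : A.toFun.val x)
    (m : toFun.val y) :
    smul x' y' (A.toFun.act f a) (toFun.act g m) = toFun.act (f ⊗ₘ g) (smul x y a m)
  mul_smul {x y z : X} (a : A.toFun.val x) (b : A.toFun.val y) (m : toFun.val z) :
    toFun.act (α_ x y z).hom (smul (x ⊗ y) z (A.mul x y a b) m) =
      smul x (y ⊗ z) a (smul y z b m)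
  one_smul {x : X} (m : toFun.val x) : toFun.act (λ_ x).hom (smul (𝟙_ X) x A.one m) = m

namespace FMod

variable {A : FMonoid R X}

/-- The group of morphisms of `A`-modules. -/
def homs (M N : FMod A) : AddSubgroup (M.toFun ⟶ N.toFun) where
  carrier := {φ | ∀ (x y : X) (a : A.toFun.val x) (m : M.toFun.val y),
    LinFun.comp φ (x ⊗ y) (M.smul x y a m) = N.smul x y a (LinFun.comp φ y m)}
  zero_mem' x y a m := by simp
  add_mem' h h' x y a m := by simp [h x y a m, h' x y a m]
  neg_mem' h x y a m := by simp [h x y a m]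

instance : Category (FMod A) where
  Hom M N := homs M N
  id M := ⟨𝟙 _, fun x y a m => by simp⟩
  comp f g := ⟨f.1 ≫ g.1, fun x y a m => by simp [f.2 x y a m, g.2 x y]⟩

instance : Preadditive (FMod A) where
  homGroup M N := inferInstanceAs (AddCommGroup (homs M N))
  add_comp _ _ _ f f' g := Subtype.ext (Preadditive.add_comp _ _ _ f.1 f'.1 g.1)
  comp_add _ _ _ f g g' := Subtype.ext (Preadditive.comp_add _ _ _ f.1 g.1 g'.1)

variable (A) in
/-- The restriction (forgetful) functor from `A`-modules to `𝓕`. -/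
def forget : FMod A ⥤ LinFun R X where
  obj M := M.toFun
  map f := f.1

instance : (forget A).Additive where

lemma hom_ext {M N : FMod A} {f g : M ⟶ N}
    (h : ∀ x m, LinFun.comp f.1 x m = LinFun.comp g.1 x m) : f = g :=
  Subtype.ext (LinFun.hom_ext h)

end FMod

end


/-! ### The tensor product of `𝓕` -/

section

variable {R : Type w} [CommRing R] {X : Type u} [Category.{v} X] [Preadditive X] [Linear R X]
  [MonoidalCategory X]

/-- Generators `[f, a, b]` of `(F ⊗ G)(z)`. -/
abbrev DayGen (F G : LinFun R X) (z : X) : Type (max u v w) :=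
  Σ x y : X, (x ⊗ y ⟶ z) × F.val x × G.val y

/-- The relations of the coend `∫^{x, y} X(x ⊗ y, z) ⊗ F(x) ⊗ G(y)`: multilinearity, and
`[(φ ⊗ ψ) ≫ f, a, b] = [f, F(φ)(a), G(ψ)(b)]`. -/
inductive DayRel (F G : LinFun R X) (z : X) : (DayGen F G z →₀ R) → Prop
  | add_hom {x y : X} (f f' : x ⊗ y ⟶ z) (a : F.val x) (b : G.val y) :
      DayRel F G z (.single ⟨x, y, f + f', a, b⟩ 1 -
        (.single ⟨x, y, f, a, b⟩ 1 + .single ⟨x, y, f', a, b⟩ 1))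
  | smul_hom {x y : X} (r : R) (f : x ⊗ y ⟶ z) (a : F.val x) (b : G.val y) :
      DayRel F G z (.single ⟨x, y, r • f, a, b⟩ 1 - r • .single ⟨x, y, f, a, b⟩ 1)
  | add_left {x y : X} (f : x ⊗ y ⟶ z) (a a' : F.val x) (b : G.val y) :
      DayRel F G z (.single ⟨x, y, f, a + a', b⟩ 1 -
        (.single ⟨x, y, f, a, b⟩ 1 + .single ⟨x, y, f, a', b⟩ 1))
  | smul_left {x y : X} (r : R) (f : x ⊗ y ⟶ z) (a : F.val x) (b : G.val y) :
      DayRel F G z (.single ⟨x, y, f, r • a, b⟩ 1 - r • .single ⟨x, y, f, a, b⟩ 1)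
  | add_right {x y : X} (f : x ⊗ y ⟶ z) (a : F.val x) (b b' : G.val y) :
      DayRel F G z (.single ⟨x, y, f, a, b + b'⟩ 1 -
        (.single ⟨x, y, f, a, b⟩ 1 + .single ⟨x, y, f, a, b'⟩ 1))
  | smul_right {x y : X} (r : R) (f : x ⊗ y ⟶ z) (a : F.val x) (b : G.val y) :
      DayRel F G z (.single ⟨x, y, f, a, r • b⟩ 1 - r • .single ⟨x, y, f, a, b⟩ 1)
  | dinatural {x x' y y' : X} (φ : x ⟶ x') (ψ : y ⟶ y') (f : x' ⊗ y' ⟶ z) (a : F.val x)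
      (b : G.val y) :
      DayRel F G z (.single ⟨x, y, (φ ⊗ₘ ψ) ≫ f, a, b⟩ 1 -
        .single ⟨x', y', f, F.act φ a, G.act ψ b⟩ 1)

/-- The coend `∫^{x, y} X(x ⊗ y, z) ⊗ F(x) ⊗ G(y)`, in a large universe. -/
abbrev DayBig (F G : LinFun R X) (z : X) : Type (max u v w) :=
  (DayGen F G z →₀ R) ⧸ Submodule.span R {t | DayRel F G z t}

namespace DayBig

variable {F G : LinFun R X}

/-- The class `[f, a, b]`, as a trilinear map. -/
def mk (F G : LinFun R X) (x y z : X) :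
    (x ⊗ y ⟶ z) →ₗ[R] F.val x →ₗ[R] G.val y →ₗ[R] DayBig F G z where
  toFun f := LinearMap.mk₂ R (fun a b => Submodule.Quotient.mk (.single ⟨x, y, f, a, b⟩ 1))
    (fun a a' b => by
      rw [← Submodule.Quotient.mk_add, Submodule.Quotient.eq]
      exact Submodule.subset_span (.add_left f a a' b))
    (fun r a b => by
      rw [← Submodule.Quotient.mk_smul, Submodule.Quotient.eq]
      exact Submodule.subset_span (.smul_left r f a b))
    (fun a b b' => by
      rw [← Submodule.Quotient.mk_add, Submodule.Quotient.eq]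
      exact Submodule.subset_span (.add_right f a b b'))
    (fun r a b => by
      rw [← Submodule.Quotient.mk_smul, Submodule.Quotient.eq]
      exact Submodule.subset_span (.smul_right r f a b))
  map_add' f f' := by
    ext a b
    simp only [LinearMap.mk₂_apply, LinearMap.add_apply]
    rw [← Submodule.Quotient.mk_add, Submodule.Quotient.eq]
    exact Submodule.subset_span (.add_hom f f' a b)
  map_smul' r f := by
    ext a b
    simp only [LinearMap.mk₂_apply, LinearMap.smul_apply, RingHom.id_apply]
    rw [← Submodule.Quotient.mk_smul, Submodule.Quotient.eq]
    exact Submodule.subset_span (.smul_hom r f a b)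

lemma mk_dinatural {x x' y y' z : X} (φ : x ⟶ x') (ψ : y ⟶ y') (f : x' ⊗ y' ⟶ z)
    (a : F.val x) (b : G.val y) :
    mk F G x y z ((φ ⊗ₘ ψ) ≫ f) a b = mk F G x' y' z f (F.act φ a) (G.act ψ b) :=
  (Submodule.Quotient.eq _).2 (Submodule.subset_span (.dinatural φ ψ f a b))

lemma induction {z : X} {p : DayBig F G z → Prop} (t : DayBig F G z)
    (h_mk : ∀ x y f a b, p (mk F G x y z f a b)) (h_zero : p 0)
    (h_add : ∀ s t, p s → p t → p (s + t)) : p t := by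
  induction t using Submodule.Quotient.induction_on with | _ t
  induction t using Finsupp.induction_linear with
  | zero => exact h_zero
  | add s t hs ht => exact h_add _ _ hs ht
  | single g r =>
    obtain ⟨x, y, f, a, b⟩ := g
    have : (Submodule.Quotient.mk (.single ⟨x, y, f, a, b⟩ r) : DayBig F G z) =
        mk F G x y z f (r • a) b := by
      rw [map_smul]
      change _ = r • Submodule.Quotient.mk _
      rw [← Submodule.Quotient.mk_smul, Finsupp.smul_single, smul_eq_mul, mul_one]
    rw [this]
    exact h_mk _ _ _ _ _

/-- Universal property of the coend. -/
def lift {z : X} {V : Type*} [AddCommGroup V] [Module R V]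
    (φ : ∀ x y, (x ⊗ y ⟶ z) →ₗ[R] F.val x →ₗ[R] G.val y →ₗ[R] V)
    (h : ∀ (x x' y y' : X) (p : x ⟶ x') (q : y ⟶ y') (f : x' ⊗ y' ⟶ z) (a : F.val x)
      (b : G.val y), φ x y ((p ⊗ₘ q) ≫ f) a b = φ x' y' f (F.act p a) (G.act q b)) :
    DayBig F G z →ₗ[R] V :=
  Submodule.liftQ _
    (Finsupp.linearCombination R fun g : DayGen F G z =>
      φ g.1 g.2.1 g.2.2.1 g.2.2.2.1 g.2.2.2.2) (by
    rw [Submodule.span_le]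
    rintro _ (_ | _ | _ | _ | _ | _ | _) <;>
      simp [h])

@[simp] lemma lift_mk {z : X} {V : Type*} [AddCommGroup V] [Module R V]
    (φ : ∀ x y, (x ⊗ y ⟶ z) →ₗ[R] F.val x →ₗ[R] G.val y →ₗ[R] V)
    (h : ∀ (x x' y y' : X) (p : x ⟶ x') (q : y ⟶ y') (f : x' ⊗ y' ⟶ z) (a : F.val x)
      (b : G.val y), φ x y ((p ⊗ₘ q) ≫ f) a b = φ x' y' f (F.act p a) (G.act q b))
    {x y : X} (f : x ⊗ y ⟶ z) (a : F.val x) (b : G.val y) :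
    lift φ h (mk F G x y z f a b) = φ x y f a b := by
  change Finsupp.linearCombination R _ (Finsupp.single _ _) = _
  simp

instance [EssentiallySmall.{w} X] (F G : LinFun R X) (z : X) : Small.{w} (DayBig F G z) := by
  let e := equivSmallModel.{w} X
  let S := Σ x y : SmallModel.{w} X, (e.inverse.obj x ⊗ e.inverse.obj y ⟶ z) ×
    F.val (e.inverse.obj x) × G.val (e.inverse.obj y)
  have : Small.{w} S := inferInstance
  let g : (Shrink.{w} S →₀ R) →ₗ[R] DayBig F G z :=
    Finsupp.linearCombination R fun s =>
      let s := (equivShrink S).symm s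
      mk F G _ _ z s.2.2.1 s.2.2.2.1 s.2.2.2.2
  have hg : ∀ s : S, g (.single (equivShrink S s) 1) =
      mk F G _ _ z s.2.2.1 s.2.2.2.1 s.2.2.2.2 := fun s => by
    simp only [g, Finsupp.linearCombination_single, one_smul]
    rw [Equiv.symm_apply_apply]
  refine small_of_surjective (f := g) fun t => ?_
  change t ∈ LinearMap.range g
  induction t using induction with
  | h_zero => exact zero_mem _
  | h_add s t hs ht => exact add_mem hs ht
  | h_mk x y f a b =>
    let i := e.unitIso.app x
    let j := e.unitIso.app y
    refine ⟨.single (equivShrink S ⟨e.functor.obj x, e.functor.obj y, (i.inv ⊗ₘ j.inv) ≫ f,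
      F.act i.hom a, G.act j.hom b⟩) 1, ?_⟩
    rw [hg, mk_dinatural, ← F.act_comp, ← G.act_comp, i.hom_inv_id, j.hom_inv_id]
    simp

end DayBig

variable [EssentiallySmall.{w} X]

/-- The value at `z` of the tensor product `F ⊗ G` in `𝓕`. -/
def DayVal (F G : LinFun R X) (z : X) : Type w := Shrink.{w} (DayBig F G z)

namespace DayVal

instance (F G : LinFun R X) (z : X) : AddCommGroup (DayVal F G z) :=
  (equivShrink (DayBig F G z)).symm.addCommGroup

instance (F G : LinFun R X) (z : X) : Module R (DayVal F G z) :=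
  (equivShrink (DayBig F G z)).symm.module R

/-- The value of `F ⊗ G` at `z` is the coend, moved to the universe of `R`. -/
def equiv (F G : LinFun R X) (z : X) : DayVal F G z ≃ₗ[R] DayBig F G z :=
  (equivShrink (DayBig F G z)).symm.linearEquiv R

variable {F G : LinFun R X}

/-- The class `[f, a, b]`, as a trilinear map. -/
def mk (F G : LinFun R X) (x y z : X) :
    (x ⊗ y ⟶ z) →ₗ[R] F.val x →ₗ[R] G.val y →ₗ[R] DayVal F G z where
  toFun f := (DayBig.mk F G x y z f).compr₂ (equiv F G z).symm.toLinearMap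
  map_add' f g := by ext; simp
  map_smul' r f := by ext; simp

lemma mk_dinatural {x x' y y' z : X} (φ : x ⟶ x') (ψ : y ⟶ y') (f : x' ⊗ y' ⟶ z)
    (a : F.val x) (b : G.val y) :
    mk F G x y z ((φ ⊗ₘ ψ) ≫ f) a b = mk F G x' y' z f (F.act φ a) (G.act ψ b) :=
  congrArg (equiv F G z).symm (DayBig.mk_dinatural φ ψ f a b)

lemma induction {z : X} {p : DayVal F G z → Prop} (t : DayVal F G z)
    (h_mk : ∀ x y f a b, p (mk F G x y z f a b)) (h_zero : p 0)
    (h_add : ∀ s t, p s → p t → p (s + t)) : p t := by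
  obtain ⟨t, rfl⟩ := (equiv F G z).symm.surjective t
  induction t using DayBig.induction with
  | h_mk x y f a b => exact h_mk x y f a b
  | h_zero => rw [map_zero]; exact h_zero
  | h_add s t hs ht => rw [map_add]; exact h_add _ _ hs ht

/-- Universal property of the coend. -/
def lift {z : X} {V : Type*} [AddCommGroup V] [Module R V]
    (φ : ∀ x y, (x ⊗ y ⟶ z) →ₗ[R] F.val x →ₗ[R] G.val y →ₗ[R] V)
    (h : ∀ (x x' y y' : X) (p : x ⟶ x') (q : y ⟶ y') (f : x' ⊗ y' ⟶ z) (a : F.val x)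
      (b : G.val y), φ x y ((p ⊗ₘ q) ≫ f) a b = φ x' y' f (F.act p a) (G.act q b)) :
    DayVal F G z →ₗ[R] V :=
  DayBig.lift φ h ∘ₗ (equiv F G z).toLinearMap

@[simp] lemma lift_mk {z : X} {V : Type*} [AddCommGroup V] [Module R V]
    (φ : ∀ x y, (x ⊗ y ⟶ z) →ₗ[R] F.val x →ₗ[R] G.val y →ₗ[R] V)
    (h : ∀ (x x' y y' : X) (p : x ⟶ x') (q : y ⟶ y') (f : x' ⊗ y' ⟶ z) (a : F.val x)
      (b : G.val y), φ x y ((p ⊗ₘ q) ≫ f) a b = φ x' y' f (F.act p a) (G.act q b))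
    {x y : X} (f : x ⊗ y ⟶ z) (a : F.val x) (b : G.val y) :
    lift φ h (mk F G x y z f a b) = φ x y f a b := by
  simp [lift, mk]

end DayVal

/-- The functoriality `[f, a, b] ↦ [f ≫ g, a, b]` of `F ⊗ G`. -/
def DayVal.act (F G : LinFun R X) (z z' : X) :
    (z ⟶ z') →ₗ[R] DayVal F G z →ₗ[R] DayVal F G z' where
  toFun g := DayVal.lift
    (fun x y => DayVal.mk F G x y z' ∘ₗ Linear.rightComp R (x ⊗ y) g)
    (fun x x' y y' p q f a b => by simp [← DayVal.mk_dinatural])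
  map_add' g g' := by
    ext t
    induction t using DayVal.induction <;> simp_all; abel
  map_smul' r g := by
    ext t
    induction t using DayVal.induction <;> simp_all

@[simp] lemma DayVal.act_mk (F G : LinFun R X) {x y z z' : X} (g : z ⟶ z') (f : x ⊗ y ⟶ z)
    (a : F.val x) (b : G.val y) :
    DayVal.act F G z z' g (DayVal.mk F G x y z f a b) = DayVal.mk F G x y z' (f ≫ g) a b :=
  DayVal.lift_mk _ _ f a b

/-- The tensor product of `𝓕`: the `R`-linear Day convolution of `F` and `G`. -/
abbrev dayTensor (F G : LinFun R X) : LinFun R X :=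
  LinFun.of (DayVal F G) (fun {z z'} => DayVal.act F G z z')
    (fun z t => by induction t using DayVal.induction <;> simp_all)
    (fun f g t => by induction t using DayVal.induction <;> simp_all)

/-- The component at `z` of the multiplication `A ⊗ A ⟶ A`, `[f, a, b] ↦ A(f)(a × b)`. -/
def FMonoid.mulVal (A : FMonoid R X) (z : X) : DayVal A.toFun A.toFun z →ₗ[R] A.toFun.val z :=
  DayVal.lift (fun x y => A.toFun.actMul (A.mul x y))
    (fun x x' y y' p q f a b => by simp [A.mul_natural, LinFun.act_comp])

@[simp] lemma FMonoid.mulVal_mk (A : FMonoid R X) {x y z : X} (f : x ⊗ y ⟶ z)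
    (a : A.toFun.val x) (b : A.toFun.val y) :
    A.mulVal z (DayVal.mk _ _ x y z f a b) = A.toFun.act f (A.mul x y a b) :=
  DayVal.lift_mk _ _ f a b

lemma FMonoid.mulVal_act (A : FMonoid R X) {z z' : X} (f : z ⟶ z')
    (t : DayVal A.toFun A.toFun z) :
    A.mulVal z' (DayVal.act _ _ z z' f t) = A.toFun.act f (A.mulVal z t) := by
  induction t using DayVal.induction with
  | h_mk x y g a b => simp [LinFun.act_comp]
  | h_zero => simp
  | h_add s t hs ht => simp [hs, ht]

/-- The multiplication `μ_A : A ⊗ A ⟶ A` of a monoid in `𝓕`. -/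
def FMonoid.mulHom (A : FMonoid R X) : dayTensor A.toFun A.toFun ⟶ A.toFun :=
  LinFun.homMk A.mulVal A.mulVal_act

/-- `A` is tensor idempotent if `μ_A` is an isomorphism in `𝓕`. -/
def FMonoid.IsTensorIdempotent (A : FMonoid R X) : Prop := IsIso A.mulHom

end


/-! ### Polynomials -/

section

variable {R : Type w} [CommRing R]

/-- For a bilinear map `β`, the bilinear map
`(∑ᵢ aᵢ tⁱ, ∑ⱼ bⱼ tʲ) ↦ ∑ᵢⱼ β(aᵢ, bⱼ) tⁱ⁺ʲ`; polynomials with coefficients in a module `V` are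
finitely supported functions from multi-indices to `V`. -/
def polyMul (σ : Type) {U V W : Type*} [AddCommGroup U] [Module R U] [AddCommGroup V] [Module R V]
    [AddCommGroup W] [Module R W] (β : U →ₗ[R] V →ₗ[R] W) :
    ((σ →₀ ℕ) →₀ U) →ₗ[R] ((σ →₀ ℕ) →₀ V) →ₗ[R] ((σ →₀ ℕ) →₀ W) :=
  Finsupp.lsum R fun i => LinearMap.flip
    (Finsupp.lsum R fun j => (β.compr₂ (Finsupp.lsingle (i + j))).flip)

@[simp] lemma polyMul_single (σ : Type) {U V W : Type*} [AddCommGroup U] [Module R U]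
    [AddCommGroup V] [Module R V] [AddCommGroup W] [Module R W] (β : U →ₗ[R] V →ₗ[R] W)
    (i j : σ →₀ ℕ) (a : U) (b : V) :
    polyMul σ β (.single i a) (.single j b) = .single (i + j) (β a b) := by
  simp [polyMul]

/-- A property of polynomials that is additive and holds for monomials holds for all. -/
lemma poly_induction {σ : Type} {U : Type*} [AddCommGroup U] {p : ((σ →₀ ℕ) →₀ U) → Prop}
    (f : (σ →₀ ℕ) →₀ U) (h_single : ∀ i a, p (.single i a)) (h_zero : p 0)
    (h_add : ∀ s t, p s → p t → p (s + t)) : p f :=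
  Finsupp.induction_linear f h_zero h_add h_single

variable {X : Type u} [Category.{v} X] [Preadditive X] [Linear R X]

/-- The functor of polynomials `F[t_s, s ∈ σ]`, `x ↦ F(x)[t_s, s ∈ σ]`, with arrows acting on
coefficients. -/
abbrev LinFun.poly (F : LinFun R X) (σ : Type) : LinFun R X :=
  LinFun.of (fun x => (σ →₀ ℕ) →₀ F.val x)
    (fun {x y} =>
      { toFun := fun f => Finsupp.mapRange.linearMap (F.act f)
        map_add' := fun f g => by ext; simp [LinFun.act_add]
        map_smul' := fun r f => by ext; simp [LinFun.act_smul] })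
    (fun x p => by ext; simp)
    (fun f g p => by ext; simp [LinFun.act_comp])

lemma LinFun.poly_act_single (F : LinFun R X) (σ : Type) {x y : X} (f : x ⟶ y) (i : σ →₀ ℕ)
    (a : F.val x) :
    (F.poly σ).act f (Finsupp.single i a : (σ →₀ ℕ) →₀ F.val x) =
      (Finsupp.single i (F.act f a) : (σ →₀ ℕ) →₀ F.val y) :=
  Finsupp.mapRange_single (hf := map_zero _)

variable [MonoidalCategory X]

/-- The monoid of polynomials `A[t_s, s ∈ σ]` over a monoid `A` in `𝓕`. -/
abbrev FMonoid.poly (A : FMonoid R X) (σ : Type) : FMonoid R X where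
  toFun := A.toFun.poly σ
  mul x y := polyMul σ (A.mul x y)
  one := (Finsupp.single 0 A.one : (σ →₀ ℕ) →₀ A.toFun.val (𝟙_ X))
  mul_natural {x x' y y'} f g p q := by
    induction p using poly_induction with
    | h_zero => simp only [map_zero, LinearMap.zero_apply]
    | h_add s t hs ht => simp only [map_add, LinearMap.add_apply, hs, ht]
    | h_single i a =>
    induction q using poly_induction with
    | h_zero => simp only [map_zero]
    | h_add s t hs ht => simp only [map_add, hs, ht]
    | h_single j b =>
    rw [LinFun.poly_act_single, LinFun.poly_act_single, polyMul_single, polyMul_single,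
      LinFun.poly_act_single, A.mul_natural]
  mul_assoc {x y z} p q r := by
    induction p using poly_induction with
    | h_zero => simp only [map_zero, LinearMap.zero_apply]
    | h_add s t hs ht => simp only [map_add, LinearMap.add_apply, hs, ht]
    | h_single i a =>
    induction q using poly_induction with
    | h_zero => simp only [map_zero, LinearMap.zero_apply]
    | h_add s t hs ht => simp only [map_add, LinearMap.add_apply, hs, ht]
    | h_single j b =>
    induction r using poly_induction with
    | h_zero => simp only [map_zero]
    | h_add s t hs ht => simp only [map_add, hs, ht]
    | h_single k c =>
    rw [polyMul_single, polyMul_single, polyMul_single, polyMul_single, LinFun.poly_act_single,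
      A.mul_assoc, add_assoc]
  one_mul {x} p := by
    induction p using poly_induction with
    | h_zero => simp only [map_zero]
    | h_add s t hs ht => simp only [map_add, hs, ht]
    | h_single i a => rw [polyMul_single, LinFun.poly_act_single, A.one_mul, zero_add]
  mul_one {x} p := by
    induction p using poly_induction with
    | h_zero => simp only [map_zero, LinearMap.zero_apply]
    | h_add s t hs ht => simp only [map_add, LinearMap.add_apply, hs, ht]
    | h_single i a => rw [polyMul_single, LinFun.poly_act_single, A.mul_one, add_zero]

instance [BraidedCategory X] (A : FMonoid R X) [A.IsComm] (σ : Type) : (A.poly σ).IsComm where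
  comm {x y} p q := by
    induction p using poly_induction with
    | h_zero => simp only [map_zero, LinearMap.zero_apply]
    | h_add s t hs ht => simp only [map_add, LinearMap.add_apply, hs, ht]
    | h_single i a =>
    induction q using poly_induction with
    | h_zero => simp only [map_zero, LinearMap.zero_apply]
    | h_add s t hs ht => simp only [map_add, LinearMap.add_apply, hs, ht]
    | h_single j b =>
    rw [polyMul_single, polyMul_single, LinFun.poly_act_single, FMonoid.IsComm.comm, add_comm]

/-- The variable `t_s`, an element of `A[t_s, s ∈ σ](𝟙)`. -/
def FMonoid.var (A : FMonoid R X) {σ : Type} (s : σ) : (A.poly σ).toFun.val (𝟙_ X) :=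
  (Finsupp.single (Finsupp.single s 1) A.one : (σ →₀ ℕ) →₀ A.toFun.val (𝟙_ X))

/-- The morphism of monoids `A[t_s, s ∈ σ] → A[t_s, s ∈ τ]` which is the identity on `A` and maps
`t_s` to `t_{e(s)}`. -/
def FMonoid.rename (A : FMonoid R X) {σ τ : Type} (e : σ → τ) : (A.poly σ).Hom (A.poly τ) where
  hom := LinFun.homMk
    (fun x => (Finsupp.lmapDomain (A.toFun.val x) R (Finsupp.mapDomain e) :
      ((σ →₀ ℕ) →₀ A.toFun.val x) →ₗ[R] ((τ →₀ ℕ) →₀ A.toFun.val x)))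
    (fun {x y} f p => by
      induction p using poly_induction with
      | h_zero => simp only [map_zero]
      | h_add s t hs ht => simp only [map_add, hs, ht]
      | h_single i a =>
      rw [LinFun.poly_act_single, Finsupp.lmapDomain_apply, Finsupp.lmapDomain_apply,
        Finsupp.mapDomain_single, Finsupp.mapDomain_single, LinFun.poly_act_single])
  map_mul {x y} p q := by
    rw [LinFun.comp_homMk, LinFun.comp_homMk, LinFun.comp_homMk]
    induction p using poly_induction with
    | h_zero => simp only [map_zero, LinearMap.zero_apply]
    | h_add s t hs ht => simp only [map_add, LinearMap.add_apply, hs, ht]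
    | h_single i a =>
    induction q using poly_induction with
    | h_zero => simp only [map_zero]
    | h_add s t hs ht => simp only [map_add, hs, ht]
    | h_single j b =>
    rw [Finsupp.lmapDomain_apply, Finsupp.lmapDomain_apply, polyMul_single,
      Finsupp.lmapDomain_apply, Finsupp.mapDomain_single, Finsupp.mapDomain_single,
      Finsupp.mapDomain_single, polyMul_single, Finsupp.mapDomain_add]
  map_one := by
    rw [LinFun.comp_homMk, Finsupp.lmapDomain_apply]
    rw [Finsupp.mapDomain_single, Finsupp.mapDomain_zero]

end


/-! ### The Koszul complex -/

section

/-- The subsets of `{1, …, n}` with `p` elements. -/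
abbrev KIdx (n p : ℕ) : Type := {S : Finset (Fin n) // S.card = p}

/-- `T ∪ {i}` for `i ∉ T`. -/
def KIdx.insert {n p : ℕ} (T : KIdx n p) (i : {i // i ∉ T.1}) : KIdx n (p + 1) :=
  ⟨Insert.insert i.1 T.1, by rw [Finset.card_insert_of_notMem i.2, T.2]⟩

/-- The sign `(-1)^{k+1}`, where `i` is the `k`-th element of `T ∪ {i}`. -/
def koszulSign {n : ℕ} (T : Finset (Fin n)) (i : Fin n) : ℤ :=
  (-1) ^ (T.filter (· < i)).card

lemma koszulSign_insert {n : ℕ} (T : Finset (Fin n)) {i j : Fin n} (hi : i ∉ T) (hj : j ∉ T)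
    (hij : i ≠ j) :
    koszulSign T i * koszulSign (insert i T) j = -(koszulSign T j * koszulSign (insert j T) i) := by
  simp only [koszulSign, Finset.filter_insert]
  rcases lt_or_gt_of_ne hij with h | h
  · rw [if_pos h, if_neg h.not_gt, Finset.card_insert_of_notMem (by simp [hi]), pow_succ]
    ring
  · rw [if_pos h, if_neg h.not_gt, Finset.card_insert_of_notMem (by simp [hj]), pow_succ]
    ring

variable {R : Type w} [CommRing R] {V : Type*} [AddCommGroup V] [Module R V]

/-- For endomorphisms `L₁, …, Lₙ` of `V`, the map `⨁_{|S| = p + 1} V → ⨁_{|S| = p} V` which on the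
summand `S = {i₁ < … < i_{p+1}}` is the sum of the `(-1)^{k+1} L_{i_k}`, with values in the
summand `S \ {i_k}`. -/
def koszulMap {n : ℕ} (L : Fin n → V →ₗ[R] V) (p : ℕ) :
    (KIdx n (p + 1) → V) →ₗ[R] (KIdx n p → V) :=
  LinearMap.pi fun T => ∑ i : {i // i ∉ T.1},
    koszulSign T.1 i.1 • (L i.1 ∘ₗ LinearMap.proj (T.insert i))

lemma koszulMap_apply {n : ℕ} (L : Fin n → V →ₗ[R] V) (p : ℕ) (c : KIdx n (p + 1) → V)
    (T : KIdx n p) :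
    koszulMap L p c T = ∑ i : {i // i ∉ T.1}, koszulSign T.1 i.1 • L i.1 (c (T.insert i)) := by
  simp [koszulMap]

lemma koszulMap_comp {n : ℕ} (L : Fin n → V →ₗ[R] V) (hL : ∀ i j v, L i (L j v) = L j (L i v))
    (p : ℕ) (c : KIdx n (p + 2) → V) : koszulMap L p (koszulMap L (p + 1) c) = 0 := by
  ext T
  simp only [koszulMap_apply, map_sum, Finset.smul_sum, map_zsmul, Pi.zero_apply, smul_smul]
  rw [Finset.sum_sigma']
  have hj : ∀ (i : {i // i ∉ T.1}) (j : {j // j ∉ (T.insert i).1}), j.1 ∉ T.1 ∧ i.1 ≠ j.1 :=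
    fun i j => by
      have := j.2
      simp only [KIdx.insert, Finset.mem_insert, not_or] at this
      exact ⟨this.2, fun h => this.1 h.symm⟩
  refine Finset.sum_involution
    (fun q _ => ⟨⟨q.2.1, (hj q.1 q.2).1⟩, ⟨q.1.1, by
      simp only [KIdx.insert, Finset.mem_insert, not_or]
      exact ⟨(hj q.1 q.2).2, q.1.2⟩⟩⟩) ?_ ?_ (fun _ _ => by simp) (fun _ _ => rfl)
  · rintro ⟨i, j⟩ -
    have h1 := koszulSign_insert T.1 i.2 (hj i j).1 (hj i j).2
    dsimp only [KIdx.insert] at h1 ⊢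
    rw [h1, hL i.1 j.1]
    simp only [Finset.insert_comm j.1 i.1 T.1, neg_smul, neg_add_cancel]
  · rintro ⟨i, j⟩ - - h
    have := congrArg (fun q => q.1.1) h
    exact (hj i j).2 this.symm

lemma koszulMap_natural {n : ℕ} {W : Type*} [AddCommGroup W] [Module R W] (L : Fin n → V →ₗ[R] V)
    (L' : Fin n → W →ₗ[R] W) (g : V →ₗ[R] W) (h : ∀ i v, L' i (g v) = g (L i v)) (p : ℕ)
    (c : KIdx n (p + 1) → V) (T : KIdx n p) :
    koszulMap L' p (fun S => g (c S)) T = g (koszulMap L p c T) := by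
  simp only [koszulMap_apply, map_sum, map_zsmul, h]

/-- The bilinear map `(a, (c_s)) ↦ (β(a, c_s))`. -/
def piMul (ι : Type) {U V W : Type*} [AddCommGroup U] [Module R U] [AddCommGroup V] [Module R V]
    [AddCommGroup W] [Module R W] (β : U →ₗ[R] V →ₗ[R] W) : U →ₗ[R] (ι → V) →ₗ[R] (ι → W) :=
  LinearMap.mk₂ R (fun a c s => β a (c s))
    (fun a a' c => by ext; simp) (fun r a c => by ext; simp) (fun a c c' => by ext; simp)
    (fun r a c => by ext; simp)

variable {X : Type u} [Category.{v} X] [Preadditive X] [Linear R X] [MonoidalCategory X]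

/-- `A` as a module over itself. -/
abbrev FMonoid.self (A : FMonoid R X) : FMod A where
  toFun := A.toFun
  smul := A.mul
  smul_natural := A.mul_natural
  mul_smul := A.mul_assoc
  one_smul := A.one_mul

/-- The map `L_a : A(x) → A(x)`, `b ↦ A(λ_x)(a × b)`, for `a ∈ A(𝟙)`. -/
def FMonoid.leftMul (A : FMonoid R X) (a : A.toFun.val (𝟙_ X)) (x : X) :
    A.toFun.val x →ₗ[R] A.toFun.val x :=
  A.toFun.act (λ_ x).hom ∘ₗ A.mul (𝟙_ X) x a

lemma FMonoid.leftMul_apply (A : FMonoid R X) (a : A.toFun.val (𝟙_ X)) (x : X)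
    (b : A.toFun.val x) : A.leftMul a x b = A.toFun.act (λ_ x).hom (A.mul (𝟙_ X) x a b) := rfl

lemma FMonoid.leftMul_act (A : FMonoid R X) (a : A.toFun.val (𝟙_ X)) {x y : X} (f : x ⟶ y)
    (b : A.toFun.val x) : A.leftMul a y (A.toFun.act f b) = A.toFun.act f (A.leftMul a x b) := by
  have := A.mul_natural (𝟙 (𝟙_ X)) f a b
  rw [LinFun.act_id] at this
  rw [leftMul_apply, leftMul_apply, this, ← LinFun.act_comp, ← LinFun.act_comp]
  simp

lemma FMonoid.leftMul_mul (A : FMonoid R X) (a : A.toFun.val (𝟙_ X)) {x y : X}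
    (b : A.toFun.val x) (c : A.toFun.val y) :
    A.leftMul a (x ⊗ y) (A.mul x y b c) = A.mul x y (A.leftMul a x b) c := by
  have h := A.mul_natural (λ_ x).hom (𝟙 y) (A.mul _ _ a b) c
  rw [LinFun.act_id] at h
  rw [leftMul_apply, leftMul_apply, h, ← A.mul_assoc, ← LinFun.act_comp]
  simp

lemma FMonoid.mul_leftMul [BraidedCategory X] (A : FMonoid R X) [A.IsComm]
    (a : A.toFun.val (𝟙_ X)) {x y : X} (b : A.toFun.val x) (c : A.toFun.val y) :
    A.mul x y b (A.leftMul a y c) = A.leftMul a (x ⊗ y) (A.mul x y b c) := by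
  have h := A.mul_natural (𝟙 x) (λ_ y).hom b (A.mul _ _ a c)
  have h' := A.mul_natural (ρ_ x).hom (𝟙 y) (A.mul _ _ b a) c
  rw [LinFun.act_id] at h h'
  rw [leftMul_mul, leftMul_apply, h, ← A.mul_assoc, ← LinFun.act_comp, leftMul_apply,
    ← FMonoid.IsComm.comm b a, ← LinFun.act_comp, braiding_leftUnitor, h']
  simp

lemma FMonoid.leftMul_comm [BraidedCategory X] (A : FMonoid R X) [A.IsComm]
    (a b : A.toFun.val (𝟙_ X)) {x : X} (c : A.toFun.val x) :
    A.leftMul a x (A.leftMul b x c) = A.leftMul b x (A.leftMul a x c) := by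
  conv_lhs => rw [leftMul_apply A b, leftMul_act, ← A.mul_leftMul]
  rfl

/-- `K_p^n(A) = ⨁_{S ⊆ {1, …, n}, |S| = p} A`. -/
abbrev koszulObj (A : FMonoid R X) (n p : ℕ) : FMod A where
  toFun := LinFun.of (fun x => KIdx n p → A.toFun.val x)
    (fun {x y} =>
      { toFun := fun f => LinearMap.pi fun S => A.toFun.act f ∘ₗ LinearMap.proj S
        map_add' := fun f g => by ext; simp [LinFun.act_add]
        map_smul' := fun r f => by ext; simp [LinFun.act_smul] })
    (fun x c => by ext; simp)
    (fun f g c => by ext; simp [LinFun.act_comp])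
  smul x y := piMul (KIdx n p) (A.mul x y)
  smul_natural f g a c := by
    funext S
    exact A.mul_natural f g a (c S)
  mul_smul a b c := by
    funext S
    exact A.mul_assoc a b (c S)
  one_smul c := by
    funext S
    exact A.one_mul (c S)

variable [BraidedCategory X]

/-- The differential `d : K_{p+1}^n(A) → K_p^n(A)` of the Koszul complex. -/
def koszulD (A : FMonoid R X) [A.IsComm] {n : ℕ} (α : Fin n → A.toFun.val (𝟙_ X)) (p : ℕ) :
    koszulObj A n (p + 1) ⟶ koszulObj A n p :=
  ⟨LinFun.homMk (fun x => koszulMap (fun i => A.leftMul (α i) x) p) (fun f c => by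
      funext T
      exact koszulMap_natural _ _ (A.toFun.act f) (fun i b => A.leftMul_act (α i) f b) p c T),
    fun x y a c => by
      funext T
      exact koszulMap_natural _ _ (A.mul x y a) (fun i b => (A.mul_leftMul (α i) a b).symm) p c T⟩

/-- The Koszul complex `K_A(α)` of `A`-modules, for a commutative monoid `A` and
`α = (α₁, …, αₙ)` in `A(𝟙)`. -/
def koszulComplex (A : FMonoid R X) [A.IsComm] {n : ℕ} (α : Fin n → A.toFun.val (𝟙_ X)) :
    ChainComplex (FMod A) ℕ :=
  ChainComplex.of (koszulObj A n) (koszulD A α) (fun p => by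
    apply FMod.hom_ext
    intro x c
    exact koszulMap_comp _ (fun i j v => A.leftMul_comm _ _ v) p c)

end


/-! ### The tensor product over a monoid -/

section

variable {R : Type w} [CommRing R] {X : Type u} [Category.{v} X] [Preadditive X] [Linear R X]
  [MonoidalCategory X] [BraidedCategory X] {B C : FMonoid R X}

/-- The right action `K(x) × B(y) → K(x ⊗ y)` of `B` on a module `K` over a commutative monoid
`C`, obtained by restriction along a morphism of monoids `r : B → C`. -/
def FMod.rsmul (r : B.Hom C) (K : FMod C) (x y : X) :
    K.toFun.val x →ₗ[R] B.toFun.val y →ₗ[R] K.toFun.val (x ⊗ y) :=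
  ((K.smul y x).compr₂ (K.toFun.act (β_ y x).hom) ∘ₗ LinFun.comp r.hom y).flip

lemma FMod.rsmul_apply (r : B.Hom C) (K : FMod C) {x y : X} (k : K.toFun.val x)
    (b : B.toFun.val y) :
    K.rsmul r x y k b = K.toFun.act (β_ y x).hom (K.smul y x (LinFun.comp r.hom y b) k) := rfl

variable [EssentiallySmall.{w} X]

/-- The relations `[f, k · b, m] = [f, k, b · m]` defining `(K ⊗_B M)(z)` as a quotient of
`(K ⊗ M)(z)`, that is, the image at `z` of the difference of the two maps
`K ⊗ B ⊗ M ⟶ K ⊗ M` given by the actions. -/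
def balRel (r : B.Hom C) (K : FMod C) (M : FMod B) (z : X) :
    Submodule R (DayVal K.toFun M.toFun z) :=
  Submodule.span R {t | ∃ (x y y' : X) (f : (x ⊗ y) ⊗ y' ⟶ z) (k : K.toFun.val x)
    (b : B.toFun.val y) (m : M.toFun.val y'),
    t = DayVal.mk _ _ (x ⊗ y) y' z f (K.rsmul r x y k b) m -
      DayVal.mk _ _ x (y ⊗ y') z ((α_ x y y').inv ≫ f) k (M.smul y y' b m)}

/-- The value `(K ⊗_B M)(z)`. -/
abbrev BalVal (r : B.Hom C) (K : FMod C) (M : FMod B) (z : X) : Type w :=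
  DayVal K.toFun M.toFun z ⧸ balRel r K M z

namespace BalVal

variable {r : B.Hom C} {K : FMod C} {M : FMod B}

/-- The class `[f, k, m]` in `(K ⊗_B M)(z)`, as a trilinear map. -/
def mk (r : B.Hom C) (K : FMod C) (M : FMod B) (x y z : X) :
    (x ⊗ y ⟶ z) →ₗ[R] K.toFun.val x →ₗ[R] M.toFun.val y →ₗ[R] BalVal r K M z where
  toFun f := (DayVal.mk K.toFun M.toFun x y z f).compr₂ (balRel r K M z).mkQ
  map_add' f g := by ext; simp
  map_smul' r f := by ext; simp

lemma mk_dinatural {x x' y y' z : X} (φ : x ⟶ x') (ψ : y ⟶ y') (f : x' ⊗ y' ⟶ z)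
    (k : K.toFun.val x) (m : M.toFun.val y) :
    mk r K M x y z ((φ ⊗ₘ ψ) ≫ f) k m = mk r K M x' y' z f (K.toFun.act φ k) (M.toFun.act ψ m) :=
  congrArg (balRel r K M z).mkQ (DayVal.mk_dinatural φ ψ f k m)

lemma mk_balanced {x y y' z : X} (f : (x ⊗ y) ⊗ y' ⟶ z) (k : K.toFun.val x)
    (b : B.toFun.val y) (m : M.toFun.val y') :
    mk r K M (x ⊗ y) y' z f (K.rsmul r x y k b) m =
      mk r K M x (y ⊗ y') z ((α_ x y y').inv ≫ f) k (M.smul y y' b m) :=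
  (Submodule.Quotient.eq _).2 (Submodule.subset_span ⟨x, y, y', f, k, b, m, rfl⟩)

lemma induction {z : X} {p : BalVal r K M z → Prop} (t : BalVal r K M z)
    (h_mk : ∀ x y f k m, p (mk r K M x y z f k m)) (h_zero : p 0)
    (h_add : ∀ s t, p s → p t → p (s + t)) : p t := by
  induction t using Submodule.Quotient.induction_on with | _ t
  induction t using DayVal.induction with
  | h_mk x y f a b => exact h_mk x y f a b
  | h_zero => exact h_zero
  | h_add s t hs ht => exact h_add _ _ hs ht

/-- Universal property of `(K ⊗_B M)(z)`. -/
def lift {z : X} {V : Type*} [AddCommGroup V] [Module R V]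
    (φ : ∀ x y, (x ⊗ y ⟶ z) →ₗ[R] K.toFun.val x →ₗ[R] M.toFun.val y →ₗ[R] V)
    (h : ∀ (x x' y y' : X) (p : x ⟶ x') (q : y ⟶ y') (f : x' ⊗ y' ⟶ z) (k : K.toFun.val x)
      (m : M.toFun.val y),
      φ x y ((p ⊗ₘ q) ≫ f) k m = φ x' y' f (K.toFun.act p k) (M.toFun.act q m))
    (h' : ∀ (x y y' : X) (f : (x ⊗ y) ⊗ y' ⟶ z) (k : K.toFun.val x) (b : B.toFun.val y)
      (m : M.toFun.val y'), φ (x ⊗ y) y' f (K.rsmul r x y k b) m =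
        φ x (y ⊗ y') ((α_ x y y').inv ≫ f) k (M.smul y y' b m)) :
    BalVal r K M z →ₗ[R] V :=
  Submodule.liftQ _ (DayVal.lift φ h) (by
    rw [balRel, Submodule.span_le]
    rintro _ ⟨x, y, y', f, k, b, m, rfl⟩
    simp [h'])

@[simp] lemma lift_mk {z : X} {V : Type*} [AddCommGroup V] [Module R V]
    (φ : ∀ x y, (x ⊗ y ⟶ z) →ₗ[R] K.toFun.val x →ₗ[R] M.toFun.val y →ₗ[R] V)
    (h : ∀ (x x' y y' : X) (p : x ⟶ x') (q : y ⟶ y') (f : x' ⊗ y' ⟶ z) (k : K.toFun.val x)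
      (m : M.toFun.val y),
      φ x y ((p ⊗ₘ q) ≫ f) k m = φ x' y' f (K.toFun.act p k) (M.toFun.act q m))
    (h' : ∀ (x y y' : X) (f : (x ⊗ y) ⊗ y' ⟶ z) (k : K.toFun.val x) (b : B.toFun.val y)
      (m : M.toFun.val y'), φ (x ⊗ y) y' f (K.rsmul r x y k b) m =
        φ x (y ⊗ y') ((α_ x y y').inv ≫ f) k (M.smul y y' b m))
    {x y : X} (f : x ⊗ y ⟶ z) (k : K.toFun.val x) (m : M.toFun.val y) :
    lift (r := r) φ h h' (mk r K M x y z f k m) = φ x y f k m :=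
  DayVal.lift_mk φ h f k m

/-- The functoriality `[f, k, m] ↦ [f ≫ g, k, m]` of `K ⊗_B M`. -/
def act (r : B.Hom C) (K : FMod C) (M : FMod B) (z z' : X) :
    (z ⟶ z') →ₗ[R] BalVal r K M z →ₗ[R] BalVal r K M z' where
  toFun g := lift (fun x y => mk r K M x y z' ∘ₗ Linear.rightComp R (x ⊗ y) g)
    (fun x x' y y' p q f a b => by simp [← mk_dinatural])
    (fun x y y' f k b m => by simp [mk_balanced])
  map_add' g g' := by
    refine LinearMap.ext fun t => ?_
    induction t using induction <;> simp_all; abel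
  map_smul' r g := by
    refine LinearMap.ext fun t => ?_
    induction t using induction <;> simp_all

@[simp] lemma act_mk {x y z z' : X} (g : z ⟶ z') (f : x ⊗ y ⟶ z) (k : K.toFun.val x)
    (m : M.toFun.val y) :
    act r K M z z' g (mk r K M x y z f k m) = mk r K M x y z' (f ≫ g) k m :=
  lift_mk (r := r) _ _ (fun x y y' f k b m => by simp [mk_balanced]) f k m

end BalVal

/-- `K ⊗_B M`, as an object of `𝓕`. -/
abbrev balFun (r : B.Hom C) (K : FMod C) (M : FMod B) : LinFun R X :=
  LinFun.of (BalVal r K M) (fun {z z'} => BalVal.act r K M z z')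
    (fun z t => by induction t using BalVal.induction <;> simp_all)
    (fun f g t => by induction t using BalVal.induction <;> simp_all)

/-- The map `K ⊗_B M → K' ⊗_B M` induced by a morphism of `C`-modules `K → K'`, at `z`. -/
def BalVal.map (r : B.Hom C) {K K' : FMod C} (φ : K ⟶ K') (M : FMod B) (z : X) :
    BalVal r K M z →ₗ[R] BalVal r K' M z :=
  BalVal.lift (r := r)
    (fun x y =>
      { toFun := fun f => BalVal.mk r K' M x y z f ∘ₗ LinFun.comp φ.1 x
        map_add' := fun f g => by ext; simp
        map_smul' := fun s f => by ext; simp })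
    (fun x x' y y' p q f k m => by
      simp [BalVal.mk_dinatural, LinFun.comp_act])
    (fun x y y' f k b m => by
      have h : LinFun.comp φ.1 (x ⊗ y) (K.rsmul r x y k b) =
          K'.rsmul r x y (LinFun.comp φ.1 x k) b := by
        rw [FMod.rsmul_apply, FMod.rsmul_apply, LinFun.comp_act, φ.2]
      simp [h, BalVal.mk_balanced])

@[simp] lemma BalVal.map_mk (r : B.Hom C) {K K' : FMod C} (φ : K ⟶ K') (M : FMod B) {x y z : X}
    (f : x ⊗ y ⟶ z) (k : K.toFun.val x) (m : M.toFun.val y) :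
    BalVal.map r φ M z (BalVal.mk r K M x y z f k m) =
      BalVal.mk r K' M x y z f (LinFun.comp φ.1 x k) m := by
  rw [BalVal.map, BalVal.lift_mk]
  rfl

/-- The map `(C ⊗_B M)(z) → M(z)`, `[f, c, m] ↦ M(f)(π(c) · m)`, induced by a morphism of monoids
`π : C → B` which is a retraction of `r`. -/
def BalVal.aug [C.IsComm] (r : B.Hom C) (π : C.Hom B)
    (hr : ∀ x b, LinFun.comp π.hom x (LinFun.comp r.hom x b) = b) (M : FMod B) (z : X) :
    BalVal r C.self M z →ₗ[R] M.toFun.val z :=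
  BalVal.lift (r := r) (fun x y => M.toFun.actMul (M.smul x y ∘ₗ LinFun.comp π.hom x))
    (fun x x' y y' p q f c m => by
      simp [LinFun.act_comp, LinFun.comp_act, M.smul_natural])
    (fun x y y' f c b m => by
      have h : (C.self.rsmul r x y c b) = C.mul x y c (LinFun.comp r.hom y b) :=
        FMonoid.IsComm.comm _ _
      simp [h, π.map_mul, hr, ← M.mul_smul, ← LinFun.act_comp _ (α_ x y y').hom])

@[simp] lemma BalVal.aug_mk [C.IsComm] (r : B.Hom C) (π : C.Hom B)
    (hr : ∀ x b, LinFun.comp π.hom x (LinFun.comp r.hom x b) = b) (M : FMod B) {x y z : X}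
    (f : x ⊗ y ⟶ z) (c : C.toFun.val x) (m : M.toFun.val y) :
    BalVal.aug r π hr M z (BalVal.mk r C.self M x y z f c m) =
      M.toFun.act f (M.smul x y (LinFun.comp π.hom x c) m) := by
  rw [BalVal.aug, BalVal.lift_mk]
  rfl

end

section

variable {R : Type w} [CommRing R] {X : Type u} [Category.{v} X] [Preadditive X] [Linear R X]
  [MonoidalCategory X] [SymmetricCategory X] {B C : FMonoid R X}

/-- The two actions of `C` on a `C`-module (on the left, and on the right through the symmetry)
commute, when `C` is commutative. -/
lemma FMod.smul_rsmul [C.IsComm] (r : B.Hom C) (K : FMod C) {x y z : X} (c : C.toFun.val x)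
    (k : K.toFun.val y) (b : B.toFun.val z) :
    K.smul x (y ⊗ z) c (K.rsmul r y z k b) =
      K.toFun.act (α_ x y z).hom (K.rsmul r (x ⊗ y) z (K.smul x y c k) b) := by
  have h1 := K.smul_natural (𝟙 x) (β_ z y).hom c (K.smul z y (LinFun.comp r.hom z b) k)
  have h2 := K.smul_natural (β_ x z).hom (𝟙 y) (C.mul x z c (LinFun.comp r.hom z b)) k
  rw [LinFun.act_id] at h1 h2
  rw [FMod.rsmul_apply, FMod.rsmul_apply, h1, ← K.mul_smul, ← K.mul_smul,
    ← FMonoid.IsComm.comm c, h2, ← LinFun.act_comp, ← LinFun.act_comp, ← LinFun.act_comp,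
    ← LinFun.act_comp]
  congr 1
  have h3 := BraidedCategory.hexagon_forward z x y
  simp only [id_tensorHom, tensorHom_id, h3, ← comp_whiskerRight_assoc,
    SymmetricCategory.symmetry, id_whiskerRight, Category.id_comp]

variable [MonoidalPreadditive X] [MonoidalLinear R X] [EssentiallySmall.{w} X]

/-- The left action of `b ∈ B(x')` on `[f, k, m]`, through `l : B → C`. -/
def BalVal.smulMk (l r : B.Hom C) (K : FMod C) (M : FMod B) (x' x y z : X) :
    (x ⊗ y ⟶ z) →ₗ[R] K.toFun.val x →ₗ[R] M.toFun.val y →ₗ[R]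
      B.toFun.val x' →ₗ[R] BalVal r K M (x' ⊗ z) where
  toFun f := LinearMap.mk₂ R
    (fun k m => ((BalVal.mk r K M (x' ⊗ x) y (x' ⊗ z) ((α_ x' x y).hom ≫ x' ◁ f)).flip m) ∘ₗ
      (K.smul x' x).flip k ∘ₗ LinFun.comp l.hom x')
    (fun k k' m => by ext; simp) (fun s k m => by ext; simp) (fun k m m' => by ext; simp)
    (fun s k m => by ext; simp)
  map_add' f g := by ext; simp
  map_smul' s f := by ext; simp

@[simp] lemma BalVal.smulMk_apply (l r : B.Hom C) (K : FMod C) (M : FMod B) {x' x y z : X}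
    (f : x ⊗ y ⟶ z) (k : K.toFun.val x) (m : M.toFun.val y) (b : B.toFun.val x') :
    BalVal.smulMk l r K M x' x y z f k m b =
      BalVal.mk r K M (x' ⊗ x) y (x' ⊗ z) ((α_ x' x y).hom ≫ x' ◁ f)
        (K.smul x' x (LinFun.comp l.hom x' b) k) m := rfl

/-- The left action `B(x') × (K ⊗_B M)(z) → (K ⊗_B M)(x' ⊗ z)`, through `l : B → C`. -/
def BalVal.smul [C.IsComm] (l r : B.Hom C) (K : FMod C) (M : FMod B) (x' z : X) :
    B.toFun.val x' →ₗ[R] BalVal r K M z →ₗ[R] BalVal r K M (x' ⊗ z) :=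
  (BalVal.lift (r := r) (fun x y => BalVal.smulMk l r K M x' x y z)
    (fun x x'' y y' p q f k m => by
      refine LinearMap.ext fun b => ?_
      have h := K.smul_natural (𝟙 x') p (LinFun.comp l.hom x' b) k
      rw [LinFun.act_id] at h
      simp only [BalVal.smulMk_apply]
      rw [h, ← BalVal.mk_dinatural]
      congr 3
      simp [MonoidalCategory.tensorHom_def])
    (fun x y y' f k b m => by
      refine LinearMap.ext fun b' => ?_
      simp only [BalVal.smulMk_apply]
      rw [K.smul_rsmul]
      have h := BalVal.mk_dinatural (r := r) (K := K) (M := M) (α_ x' x y).hom (𝟙 y')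
        ((α_ x' (x ⊗ y) y').hom ≫ x' ◁ f)
        (K.rsmul r (x' ⊗ x) y (K.smul x' x (LinFun.comp l.hom x' b') k) b) m
      rw [LinFun.act_id] at h
      rw [← h, BalVal.mk_balanced]
      congr 3
      simp)).flip

@[simp] lemma BalVal.smul_mk [C.IsComm] (l r : B.Hom C) (K : FMod C) (M : FMod B) {x' x y z : X}
    (b : B.toFun.val x') (f : x ⊗ y ⟶ z) (k : K.toFun.val x) (m : M.toFun.val y) :
    BalVal.smul l r K M x' z b (BalVal.mk r K M x y z f k m) =
      BalVal.mk r K M (x' ⊗ x) y (x' ⊗ z) ((α_ x' x y).hom ≫ x' ◁ f)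
        (K.smul x' x (LinFun.comp l.hom x' b) k) m := by
  rw [BalVal.smul, LinearMap.flip_apply, BalVal.lift_mk, BalVal.smulMk_apply]

/-- The `B`-module `K ⊗_B M`, for a module `K` over a commutative monoid `C`, seen as a
`(B, B)`-bimodule through `l : B → C` on the left and `r : B → C` on the right. -/
abbrev balTensor [C.IsComm] (l r : B.Hom C) (K : FMod C) (M : FMod B) : FMod B where
  toFun := balFun r K M
  smul := BalVal.smul l r K M
  smul_natural {x x' y y'} f g b t := by
    change BalVal.smul l r K M x' y' (B.toFun.act f b) (BalVal.act r K M y y' g t) =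
      BalVal.act r K M _ _ (f ⊗ₘ g) (BalVal.smul l r K M x y b t)
    induction t using BalVal.induction with
    | h_zero => simp only [map_zero]
    | h_add s t hs ht => simp only [map_add, hs, ht]
    | h_mk x₁ y₁ e k m =>
      have h := K.smul_natural f (𝟙 x₁) (LinFun.comp l.hom x b) k
      rw [LinFun.act_id] at h
      have h' := BalVal.mk_dinatural (r := r) (K := K) (M := M) (f ⊗ₘ 𝟙 x₁) (𝟙 y₁)
        ((α_ x' x₁ y₁).hom ≫ x' ◁ (e ≫ g)) (K.smul x x₁ (LinFun.comp l.hom x b) k) m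
      rw [LinFun.act_id] at h'
      rw [BalVal.act_mk, BalVal.smul_mk, BalVal.smul_mk, BalVal.act_mk, LinFun.comp_act, h, ← h']
      congr 3
      simp [MonoidalCategory.tensorHom_def, whisker_exchange_assoc]
  mul_smul {x y z} a b t := by
    change BalVal.act r K M _ _ (α_ x y z).hom (BalVal.smul l r K M _ z (B.mul x y a b) t) =
      BalVal.smul l r K M x _ a (BalVal.smul l r K M y z b t)
    induction t using BalVal.induction with
    | h_zero => simp only [map_zero]
    | h_add s t hs ht => simp only [map_add, hs, ht]
    | h_mk x₁ y₁ e k m =>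
      have h' := BalVal.mk_dinatural (r := r) (K := K) (M := M) (α_ x y x₁).hom (𝟙 y₁)
        ((α_ x (y ⊗ x₁) y₁).hom ≫ x ◁ ((α_ y x₁ y₁).hom ≫ y ◁ e))
        (K.smul (x ⊗ y) x₁ (C.mul x y (LinFun.comp l.hom x a) (LinFun.comp l.hom y b)) k) m
      rw [LinFun.act_id, K.mul_smul] at h'
      rw [BalVal.smul_mk, BalVal.smul_mk, BalVal.smul_mk, BalVal.act_mk, l.map_mul, ← h']
      congr 3
      simp
  one_smul {x} t := by
    change BalVal.act r K M _ _ (λ_ x).hom (BalVal.smul l r K M _ x B.one t) = t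
    induction t using BalVal.induction with
    | h_zero => simp only [map_zero]
    | h_add s t hs ht => simp only [map_add, hs, ht]
    | h_mk x₁ y₁ e k m =>
      have h' := BalVal.mk_dinatural (r := r) (K := K) (M := M) (λ_ x₁).hom (𝟙 y₁) e
        (K.smul (𝟙_ X) x₁ C.one k) m
      rw [LinFun.act_id, K.one_smul] at h'
      rw [BalVal.smul_mk, BalVal.act_mk, l.map_one, ← h']
      congr 3
      simp

/-- The functor `- ⊗_B M` from `C`-modules to `B`-modules. -/
def balFunctor [C.IsComm] (l r : B.Hom C) (M : FMod B) : FMod C ⥤ FMod B where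
  obj K := balTensor l r K M
  map {K K'} φ := ⟨LinFun.homMk (fun z => BalVal.map r φ M z) (fun {z z'} g t => by
      change BalVal.map r φ M z' (BalVal.act r K M z z' g t) =
        BalVal.act r K' M z z' g (BalVal.map r φ M z t)
      induction t using BalVal.induction with
      | h_zero => simp only [map_zero]
      | h_add s t hs ht => simp only [map_add, hs, ht]
      | h_mk x y f k m => simp),
    fun x z b t => by
      change BalVal.map r φ M _ (BalVal.smul l r K M x z b t) =
        BalVal.smul l r K' M x z b (BalVal.map r φ M z t)
      induction t using BalVal.induction with
      | h_zero => simp only [map_zero]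
      | h_add s t hs ht => simp only [map_add, hs, ht]
      | h_mk x y f k m => simp [φ.2 _ _]⟩
  map_id K := by
    apply FMod.hom_ext
    intro z t
    change BalVal.map r (𝟙 K) M z t = t
    induction t using BalVal.induction with
    | h_zero => simp only [map_zero]
    | h_add s t hs ht => simp only [map_add, hs, ht]
    | h_mk x y f k m => rw [BalVal.map_mk]; rfl
  map_comp {K K' K''} φ ψ := by
    apply FMod.hom_ext
    intro z t
    change BalVal.map r (φ ≫ ψ) M z t = BalVal.map r ψ M z (BalVal.map r φ M z t)
    induction t using BalVal.induction with
    | h_zero => simp only [map_zero]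
    | h_add s t hs ht => simp only [map_add, hs, ht]
    | h_mk x y f k m => rw [BalVal.map_mk, BalVal.map_mk, BalVal.map_mk]; rfl

instance [C.IsComm] (l r : B.Hom C) (M : FMod B) : (balFunctor l r M).Additive where
  map_add {K K' φ ψ} := by
    apply FMod.hom_ext
    intro z t
    change BalVal.map r (φ + ψ) M z t = BalVal.map r φ M z t + BalVal.map r ψ M z t
    induction t using BalVal.induction with
    | h_zero => simp only [map_zero, add_zero]
    | h_add s t hs ht => rw [map_add, map_add, map_add, hs, ht]; abel
    | h_mk x y f k m =>
      rw [BalVal.map_mk, BalVal.map_mk, BalVal.map_mk, ← LinearMap.add_apply, ← map_add]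
      rfl

/-- The morphism of `B`-modules `C ⊗_B M → M`, `[f, c, m] ↦ M(f)(π(c) · m)`, induced by a morphism
of monoids `π : C → B` which is a retraction of `l` and of `r`. -/
def balAug [C.IsComm] (l r : B.Hom C) (π : C.Hom B)
    (hl : ∀ x b, LinFun.comp π.hom x (LinFun.comp l.hom x b) = b)
    (hr : ∀ x b, LinFun.comp π.hom x (LinFun.comp r.hom x b) = b) (M : FMod B) :
    (balFunctor l r M).obj C.self ⟶ M :=
  ⟨LinFun.homMk (BalVal.aug r π hr M) (fun {z z'} g t => by
      change BalVal.aug r π hr M z' (BalVal.act r C.self M z z' g t) =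
        M.toFun.act g (BalVal.aug r π hr M z t)
      induction t using BalVal.induction with
      | h_zero => simp only [map_zero]
      | h_add s t hs ht => simp only [map_add, hs, ht]
      | h_mk x y f c m =>
        rw [BalVal.act_mk, BalVal.aug_mk, BalVal.aug_mk, LinFun.act_comp]),
    fun x' z b t => by
      change BalVal.aug r π hr M _ (BalVal.smul l r C.self M x' z b t) =
        M.smul x' z b (BalVal.aug r π hr M z t)
      induction t using BalVal.induction with
      | h_zero => simp only [map_zero]
      | h_add s t hs ht => simp only [map_add, hs, ht]
      | h_mk x y f c m =>
        have h := M.smul_natural (𝟙 x') f b (M.smul x y (LinFun.comp π.hom x c) m)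
        rw [LinFun.act_id] at h
        rw [BalVal.smul_mk, BalVal.aug_mk, BalVal.aug_mk, h, ← M.mul_smul, π.map_mul, hl,
          LinFun.act_comp, id_tensorHom]⟩

end

/-! ### Relative projectivity and split resolutions -/

section

variable {𝒞 𝒟 : Type*} [Category 𝒞] [Category 𝒟]

/-- `P` is projective relative to a functor `U : 𝒞 ⥤ 𝒟` (`𝒟`-projective) if morphisms from `P`
lift along every morphism `g` of `𝒞` such that `U(g)` is a split epimorphism. -/
def RelProjective (U : 𝒞 ⥤ 𝒟) (P : 𝒞) : Prop :=
  ∀ ⦃L N : 𝒞⦄ (g : L ⟶ N), IsSplitEpi (U.map g) → ∀ f : P ⟶ N, ∃ h : P ⟶ L, h ≫ g = f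

/-- A complex is split if there are maps `s` (of degree `1`) with `d s d = d`. -/
def IsSplitComplex [Preadditive 𝒟] (L : ChainComplex 𝒟 ℕ) : Prop :=
  ∃ s : ∀ i, L.X i ⟶ L.X (i + 1), ∀ i, L.d (i + 1) i ≫ s i ≫ L.d (i + 1) i = L.d (i + 1) i

/-- The complex `… → L₁ → L₀ → M → 0` is a `𝒟`-split resolution of `M`: it is exact in `𝒞`, and its
image under `U : 𝒞 ⥤ 𝒟` is a split complex. -/
structure IsSplitResolution [Preadditive 𝒞] [Preadditive 𝒟] (U : 𝒞 ⥤ 𝒟) [U.Additive]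
    (L : ChainComplex 𝒞 ℕ) {M : 𝒞} (ε : L.X 0 ⟶ M) (hε : L.d 1 0 ≫ ε = 0) : Prop where
  exact : (L.augment ε hε).Acyclic
  split : IsSplitComplex ((U.mapHomologicalComplex _).obj (L.augment ε hε))

end

/-! ### The Koszul resolution of `A[t₁, …, tₙ]`, tensored with a module -/

section

variable {R : Type w} [CommRing R] {X : Type u} [Category.{v} X] [Preadditive X] [Linear R X]
  [MonoidalCategory X]

/-- `A[u₁, …, uₙ, v₁, …, vₙ]`. -/
abbrev FMonoid.poly₂ (A : FMonoid R X) (n : ℕ) : FMonoid R X := A.poly (Fin n ⊕ Fin n)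

/-- The morphism of monoids `A[t] → A[u, v]`, `tᵢ ↦ uᵢ`. -/
def FMonoid.uIncl (A : FMonoid R X) (n : ℕ) : (A.poly (Fin n)).Hom (A.poly₂ n) :=
  A.rename Sum.inl

/-- The morphism of monoids `A[t] → A[u, v]`, `tᵢ ↦ vᵢ`. -/
def FMonoid.vIncl (A : FMonoid R X) (n : ℕ) : (A.poly (Fin n)).Hom (A.poly₂ n) :=
  A.rename Sum.inr

/-- The morphism of monoids `A[u, v] → A[t]`, `uᵢ ↦ tᵢ`, `vᵢ ↦ tᵢ`. When `A` is tensor idempotent,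
it corresponds to the multiplication of `A[t]` under `A[t] ⊗ A[t] ≅ A[u, v]`. -/
def FMonoid.fold (A : FMonoid R X) (n : ℕ) : (A.poly₂ n).Hom (A.poly (Fin n)) :=
  A.rename (Sum.elim id id)

/-- The elements `αᵢ = uᵢ - vᵢ`. -/
def FMonoid.diff (A : FMonoid R X) (n : ℕ) (i : Fin n) : (A.poly₂ n).toFun.val (𝟙_ X) :=
  A.var (Sum.inl i) - A.var (Sum.inr i)

lemma FMonoid.rename_rename (A : FMonoid R X) {σ τ υ : Type} (e : σ → τ) (e' : τ → υ) (x : X)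
    (p : (A.poly σ).toFun.val x) :
    LinFun.comp (A.rename e').hom x (LinFun.comp (A.rename e).hom x p) =
      LinFun.comp (A.rename (e' ∘ e)).hom x p := by
  change Finsupp.mapDomain _ (Finsupp.mapDomain _ _) = Finsupp.mapDomain _ _
  rw [← Finsupp.mapDomain_comp]
  congr 1
  funext i
  exact Finsupp.mapDomain_comp.symm

lemma FMonoid.rename_id (A : FMonoid R X) {σ : Type} (x : X) (p : (A.poly σ).toFun.val x) :
    LinFun.comp (A.rename id).hom x p = p := by
  change Finsupp.mapDomain _ _ = _
  rw [show (Finsupp.mapDomain id : (σ →₀ ℕ) → (σ →₀ ℕ)) = id from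
    funext fun i => Finsupp.mapDomain_id, Finsupp.mapDomain_id]

lemma FMonoid.fold_uIncl (A : FMonoid R X) (n : ℕ) (x : X) (p : (A.poly (Fin n)).toFun.val x) :
    LinFun.comp (A.fold n).hom x (LinFun.comp (A.uIncl n).hom x p) = p := by
  rw [fold, uIncl, rename_rename]
  exact A.rename_id x p

lemma FMonoid.fold_vIncl (A : FMonoid R X) (n : ℕ) (x : X) (p : (A.poly (Fin n)).toFun.val x) :
    LinFun.comp (A.fold n).hom x (LinFun.comp (A.vIncl n).hom x p) = p := by
  rw [fold, vIncl, rename_rename]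
  exact A.rename_id x p

/-- The isomorphism `K_0^n(A) → A`. -/
def koszulZero (A : FMonoid R X) (n : ℕ) : koszulObj A n 0 ⟶ A.self :=
  ⟨LinFun.homMk (fun _ => LinearMap.proj (⟨∅, rfl⟩ : KIdx n 0)) (fun _ _ => rfl),
    fun _ _ _ _ => rfl⟩

variable [SymmetricCategory X] [MonoidalPreadditive X] [MonoidalLinear R X]
  [EssentiallySmall.{w} X] (A : FMonoid R X) [A.IsComm] (n : ℕ) (M : FMod (A.poly (Fin n)))

/-- The complex of `A[t]`-modules `K_C(α) ⊗_{A[t]} M`, where `C = A[u, v]`, an `A[t]`-bimodule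
through `u` on the left and through `v` on the right, and `αᵢ = uᵢ - vᵢ`. -/
def koszulTensor : ChainComplex (FMod (A.poly (Fin n))) ℕ :=
  ((balFunctor (A.uIncl n) (A.vIncl n) M).mapHomologicalComplex _).obj
    (koszulComplex (A.poly₂ n) (A.diff n))

/-- The augmentation `C ⊗_{A[t]} M → A[t] ⊗_{A[t]} M ≅ M`. -/
def koszulTensorAug : (koszulTensor A n M).X 0 ⟶ M :=
  (balFunctor (A.uIncl n) (A.vIncl n) M).map (koszulZero (A.poly₂ n) n) ≫
    balAug (A.uIncl n) (A.vIncl n) (A.fold n) (A.fold_uIncl n) (A.fold_vIncl n) M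

end

end

/-!
The morphism of monoids fixing the `uᵢ` and sending `vᵢ` to `tᵢ` identifies `C ⊗_{A[t]} M` with the
polynomials `M[u]`, and `αᵢ = uᵢ - vᵢ` with the operator `uᵢ - tᵢ`, where `tᵢ` acts on coefficients.
Since `uᵢ - tᵢ` is monic in `uᵢ`, division by it has a quotient, which is a left inverse of
multiplication by `uᵢ - tᵢ` and commutes with `uⱼ - tⱼ` for `j ≠ i`; the remainder is evaluation at
`uᵢ = tᵢ`. Commuting operators with such left inverses have a contractible Koszul complex, and the
composite of the remainders is the evaluation `M[u] → M`, whence a contraction of the augmented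
complex. It is natural in the object of `𝒳` and so a contraction in `𝓕`, although it is not
`A[u]`-linear.

If `A` is tensor idempotent, every morphism of `𝓕` between `A`-modules is `A`-linear, so a splitting
in `𝓕` of an epimorphism onto an `A[u]`-module `N` lifts morphisms `M → N` of `A`-modules, and hence
morphisms `M[u] → N` of `A[u]`-modules.
-/

noncomputable section

/-! ### Contracting the Koszul complex -/

section

variable {A ι : Type*} [Ring A]

/-- Left inverses `Dᵢ` of commuting elements `Lᵢ` of a ring which commute with the other `Lⱼ`. For
endomorphisms of a module they contract the Koszul complex of `L`, see `koszulHtpy`. -/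
structure CompatibleLeftInverses (L D : ι → A) : Prop where
  commute (i j : ι) : Commute (L i) (L j)
  mul_eq_one (i : ι) : D i * L i = 1
  commute_of_ne {i j : ι} (h : i ≠ j) : Commute (L i) (D j)

/-- The idempotent `1 - Lᵢ Dᵢ`, which for a left inverse `Dᵢ` of `Lᵢ` is a projection along the
image of `Lᵢ`. -/
def residue (L D : ι → A) (i : ι) : A := 1 - L i * D i

namespace CompatibleLeftInverses

lemma residue_mul {L D : ι → A} (h : CompatibleLeftInverses L D) (i : ι) :
    residue L D i * L i = 0 := by
  rw [residue, sub_mul, mul_assoc, h.mul_eq_one, one_mul, mul_one, sub_self]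

lemma commute_residue {L D : ι → A} (h : CompatibleLeftInverses L D) {i j : ι} (hij : i ≠ j) :
    Commute (L i) (residue L D j) :=
  (Commute.one_right _).sub_right ((h.commute i j).mul_right (h.commute_of_ne hij))

variable {n : ℕ} {L D : Fin n → A} (h : CompatibleLeftInverses L D)

include h

lemma commute_partialProd_residue {i : Fin n} {k : Fin (n + 1)} (hk : k ≤ i.castSucc) :
    Commute (L i) (Fin.partialProd (residue L D) k) := by
  induction k using Fin.induction with
  | zero => simp
  | succ j ih =>
    rw [Fin.partialProd_succ]
    exact (ih (j.castSucc_lt_succ.le.trans hk)).mul_right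
      (h.commute_residue (Fin.succ_le_castSucc_iff.1 hk).ne')

lemma partialProd_residue_mul {i : Fin n} {k : Fin (n + 1)} (hk : i.castSucc < k) :
    Fin.partialProd (residue L D) k * L i = 0 := by
  induction k using Fin.induction with
  | zero => exact absurd hk (Fin.not_lt_zero _)
  | succ j ih =>
    rw [Fin.partialProd_succ, mul_assoc]
    rcases (Fin.castSucc_lt_succ_iff.1 hk).eq_or_lt with rfl | hij
    · rw [h.residue_mul, mul_zero]
    · rw [← (h.commute_residue hij.ne).eq, ← mul_assoc, ih (Fin.castSucc_lt_castSucc_iff.2 hij),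
        zero_mul]

lemma sum_mul_partialProd_residue_mul (k : Fin (n + 1)) :
    ∑ i with i.castSucc < k, L i * Fin.partialProd (residue L D) i.castSucc * D i =
      1 - Fin.partialProd (residue L D) k := by
  induction k using Fin.induction with
  | zero => simp
  | succ j ih =>
    have hj : ({i | i.castSucc < j.succ} : Finset (Fin n)) =
        insert j ({i | i.castSucc < j.castSucc} : Finset (Fin n)) := by
      ext i
      simp [le_iff_eq_or_lt]
    have hD : L j * D j = 1 - residue L D j := (sub_sub_cancel _ _).symm
    rw [hj, Finset.sum_insert (by simp), ih, Fin.partialProd_succ,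
      (h.commute_partialProd_residue le_rfl).eq, mul_assoc, hD]
    noncomm_ring

end CompatibleLeftInverses

end

namespace KIdx

variable {n p : ℕ}

lemma nonempty (S : KIdx n (p + 1)) : S.1.Nonempty :=
  Finset.card_pos.1 (S.2.symm ▸ p.succ_pos)

/-- The smallest element of `S`. -/
def min (S : KIdx n (p + 1)) : Fin n := S.1.min' S.nonempty

lemma min_mem (S : KIdx n (p + 1)) : S.min ∈ S.1 := Finset.min'_mem _ _

lemma min_le (S : KIdx n (p + 1)) {i : Fin n} (h : i ∈ S.1) : S.min ≤ i :=
  Finset.min'_le _ _ h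

lemma min_eq (S : KIdx n (p + 1)) {i : Fin n} (h : i ∈ S.1) (h' : ∀ j ∈ S.1, i ≤ j) : S.min = i :=
  le_antisymm (S.min_le h) (h' _ S.min_mem)

/-- `S` without its smallest element. -/
def eraseMin (S : KIdx n (p + 1)) : KIdx n p :=
  ⟨S.1.erase S.min, by rw [Finset.card_erase_of_mem S.min_mem, S.2, Nat.add_sub_cancel]⟩

lemma min_insert_of_forall_lt (T : KIdx n p) (i : {i // i ∉ T.1}) (h : ∀ j ∈ T.1, i.1 < j) :
    (T.insert i).min = i.1 :=
  min_eq _ (Finset.mem_insert_self _ _) (Finset.forall_mem_insert _ _ _ |>.2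
    ⟨le_rfl, fun j hj => (h j hj).le⟩)

lemma eraseMin_insert_of_forall_lt (T : KIdx n p) (i : {i // i ∉ T.1}) (h : ∀ j ∈ T.1, i.1 < j) :
    (T.insert i).eraseMin = T := by
  have hval : (T.insert i).eraseMin.1 = (T.insert i).1.erase i.1 :=
    congrArg (T.insert i).1.erase (min_insert_of_forall_lt T i h)
  exact Subtype.ext (hval.trans (Finset.erase_insert i.2))

lemma min_insert_of_min_lt (T : KIdx n (p + 1)) (i : {i // i ∉ T.1}) (h : T.min < i.1) :
    (T.insert i).min = T.min :=
  min_eq _ (Finset.mem_insert_of_mem T.min_mem) (Finset.forall_mem_insert _ _ _ |>.2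
    ⟨h.le, fun _ => T.min_le⟩)

lemma notMem_eraseMin (T : KIdx n (p + 1)) {i : Fin n} (h : i ∉ T.1) : i ∉ T.eraseMin.1 :=
  fun hi => h (Finset.mem_of_mem_erase hi)

lemma eraseMin_insert_of_min_lt (T : KIdx n (p + 1)) (i : {i // i ∉ T.1}) (h : T.min < i.1) :
    (T.insert i).eraseMin = T.eraseMin.insert ⟨i.1, T.notMem_eraseMin i.2⟩ := by
  have hval : (T.insert i).eraseMin.1 = (T.insert i).1.erase T.min :=
    congrArg (T.insert i).1.erase (min_insert_of_min_lt T i h)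
  exact Subtype.ext (hval.trans (Finset.erase_insert_of_ne h.ne'))

lemma min_notMem_eraseMin (T : KIdx n (p + 1)) : T.min ∉ T.eraseMin.1 :=
  Finset.notMem_erase _ _

lemma insert_min_eraseMin (T : KIdx n (p + 1)) :
    T.eraseMin.insert ⟨T.min, T.min_notMem_eraseMin⟩ = T :=
  Subtype.ext (Finset.insert_erase T.min_mem)

end KIdx

lemma koszulSign_of_forall_le {n : ℕ} {T : Finset (Fin n)} {i : Fin n} (h : ∀ j ∈ T, i ≤ j) :
    koszulSign T i = 1 := by
  rw [koszulSign, Finset.filter_false_of_mem (fun j hj => not_lt.2 (h j hj)), Finset.card_empty,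
    pow_zero]

lemma koszulSign_erase {n : ℕ} {T : Finset (Fin n)} {i j : Fin n} (hj : j ∈ T) (h : j < i) :
    koszulSign (T.erase j) i = -koszulSign T i := by
  have hmem : j ∈ T.filter (· < i) := Finset.mem_filter.2 ⟨hj, h⟩
  rw [koszulSign, koszulSign, Finset.filter_erase, ← Finset.card_erase_add_one hmem, pow_succ]
  ring

section

variable {R : Type*} [CommRing R] {V : Type*} [AddCommGroup V] [Module R V] {n : ℕ}

/-- The `i`-th term of the component of `koszulMap L p c` at `T`, set to `0` for `i ∈ T`. -/
def koszulTerm {p : ℕ} (L : Fin n → Module.End R V) (c : KIdx n (p + 1) → V) (T : KIdx n p)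
    (i : Fin n) : V :=
  if h : i ∈ T.1 then 0 else koszulSign T.1 i • L i (c (T.insert ⟨i, h⟩))

lemma koszulMap_eq_sum_koszulTerm (L : Fin n → Module.End R V) {p : ℕ} (c : KIdx n (p + 1) → V)
    (T : KIdx n p) : koszulMap L p c T = ∑ i, koszulTerm L c T i := by
  simp only [koszulMap_apply, koszulTerm, Finset.sum_dite, Finset.sum_const_zero, zero_add]
  exact Finset.sum_bij (fun i _ => ⟨i.1, by simp [i.2]⟩) (by simp)
    (fun i _ j _ h => Subtype.ext (by simpa using h))
    (fun i _ => ⟨⟨i.1, (Finset.mem_filter.1 i.2).2⟩, by simp, rfl⟩) (fun i _ => rfl)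

/-- The contracting homotopy `⨁_{|S| = p} V → ⨁_{|S| = p + 1} V` of the Koszul complex of `L` given
by compatible left inverses `D`. With `Eᵢ = 1 - Lᵢ Dᵢ`, its component at `S` is `E₁ ⋯ E_{m-1} D_m`
applied to the component at `S \ {m}`, where `m = min S`. -/
def koszulHtpy (L D : Fin n → Module.End R V) (p : ℕ) :
    (KIdx n p → V) →ₗ[R] (KIdx n (p + 1) → V) :=
  LinearMap.pi fun S => (Fin.partialProd (residue L D) S.min.castSucc * D S.min) ∘ₗ
    LinearMap.proj S.eraseMin

lemma koszulHtpy_apply (L D : Fin n → Module.End R V) {p : ℕ} (c : KIdx n p → V)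
    (S : KIdx n (p + 1)) :
    koszulHtpy L D p c S =
      Fin.partialProd (residue L D) S.min.castSucc (D S.min (c S.eraseMin)) := rfl

lemma koszulTerm_koszulHtpy_of_forall_lt (L D : Fin n → Module.End R V) {p : ℕ} (c : KIdx n p → V)
    (T : KIdx n p) {i : Fin n} (h : ∀ j ∈ T.1, i < j) :
    koszulTerm L (koszulHtpy L D p c) T i =
      (L i * Fin.partialProd (residue L D) i.castSucc * D i) (c T) := by
  have hi : i ∉ T.1 := fun hi => (h i hi).false
  rw [koszulTerm, dif_neg hi, koszulSign_of_forall_le (fun j hj => (h j hj).le), one_smul,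
    koszulHtpy_apply, KIdx.min_insert_of_forall_lt _ _ h, KIdx.eraseMin_insert_of_forall_lt _ _ h]
  rfl

namespace CompatibleLeftInverses

variable {L D : Fin n → Module.End R V} (h : CompatibleLeftInverses L D)

include h

lemma koszulMap_koszulHtpy_zero (c : KIdx n 0 → V) (T : KIdx n 0) :
    koszulMap L 0 (koszulHtpy L D 0 c) T =
      c T - Fin.partialProd (residue L D) (Fin.last n) (c T) := by
  have hT : T.1 = ∅ := Finset.card_eq_zero.1 T.2
  have htel := LinearMap.congr_fun (h.sum_mul_partialProd_residue_mul (Fin.last n)) (c T)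
  simp only [Fin.castSucc_lt_last, Finset.filter_true, LinearMap.sum_apply] at htel
  rw [koszulMap_eq_sum_koszulTerm]
  simp only [koszulTerm_koszulHtpy_of_forall_lt L D c T (by simp [hT])]
  exact htel

lemma partialProd_koszulTerm_eraseMin_of_lt {p : ℕ} (c : KIdx n (p + 1) → V)
    (T : KIdx n (p + 1)) {i : Fin n} (hi : i < T.min) :
    Fin.partialProd (residue L D) T.min.castSucc (D T.min (koszulTerm L c T.eraseMin i)) = 0 := by
  have hzero (v : V) : Fin.partialProd (residue L D) T.min.castSucc (D T.min (L i v)) = 0 := by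
    have hcomm : D T.min (L i v) = L i (D T.min v) :=
      LinearMap.congr_fun (h.commute_of_ne hi.ne).eq.symm v
    rw [hcomm]
    exact LinearMap.congr_fun (h.partialProd_residue_mul (Fin.castSucc_lt_castSucc_iff.2 hi)) _
  rw [koszulTerm]
  split_ifs
  · rw [map_zero, map_zero]
  · rw [map_zsmul, map_zsmul, hzero, smul_zero]

lemma partialProd_koszulTerm_eraseMin_min {p : ℕ} (c : KIdx n (p + 1) → V) (T : KIdx n (p + 1)) :
    Fin.partialProd (residue L D) T.min.castSucc (D T.min (koszulTerm L c T.eraseMin T.min)) =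
      Fin.partialProd (residue L D) T.min.castSucc (c T) := by
  have hinv (v : V) : D T.min (L T.min v) = v := LinearMap.congr_fun (h.mul_eq_one _) v
  have hsign : koszulSign T.eraseMin.1 T.min = 1 :=
    koszulSign_of_forall_le fun j hj => T.min_le (Finset.mem_of_mem_erase hj)
  rw [koszulTerm, dif_neg T.min_notMem_eraseMin, KIdx.insert_min_eraseMin, hsign, one_smul, hinv]

lemma koszulTerm_koszulHtpy_add_of_min_lt {p : ℕ} (c : KIdx n (p + 1) → V) (T : KIdx n (p + 1))
    {i : Fin n} (hi : T.min < i) :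
    koszulTerm L (koszulHtpy L D (p + 1) c) T i +
      Fin.partialProd (residue L D) T.min.castSucc (D T.min (koszulTerm L c T.eraseMin i)) = 0 := by
  by_cases hiT : i ∈ T.1
  · have hiE : i ∈ T.eraseMin.1 := Finset.mem_erase.2 ⟨hi.ne', hiT⟩
    rw [koszulTerm, koszulTerm, dif_pos hiT, dif_pos hiE, map_zero, map_zero, add_zero]
  · have hcomm : Commute (L i) (Fin.partialProd (residue L D) T.min.castSucc * D T.min) :=
      (h.commute_partialProd_residue (Fin.castSucc_le_castSucc_iff.2 hi.le)).mul_right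
        (h.commute_of_ne hi.ne')
    have hcomm_apply (v : V) : L i (Fin.partialProd (residue L D) T.min.castSucc (D T.min v)) =
        Fin.partialProd (residue L D) T.min.castSucc (D T.min (L i v)) :=
      LinearMap.congr_fun hcomm.eq v
    have hsign : koszulSign T.eraseMin.1 i = -koszulSign T.1 i := koszulSign_erase T.min_mem hi
    rw [koszulTerm, koszulTerm, dif_neg hiT, dif_neg (T.notMem_eraseMin hiT), koszulHtpy_apply,
      KIdx.min_insert_of_min_lt _ _ hi, KIdx.eraseMin_insert_of_min_lt _ _ hi, hsign, hcomm_apply,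
      map_zsmul, map_zsmul, neg_smul, add_neg_cancel]

lemma koszulMap_koszulHtpy_succ {p : ℕ} (c : KIdx n (p + 1) → V) :
    koszulMap L (p + 1) (koszulHtpy L D (p + 1) c) + koszulHtpy L D p (koszulMap L p c) = c := by
  funext T
  have hterm (i : Fin n) : koszulTerm L (koszulHtpy L D (p + 1) c) T i +
      Fin.partialProd (residue L D) T.min.castSucc (D T.min (koszulTerm L c T.eraseMin i)) =
      (if i < T.min then (L i * Fin.partialProd (residue L D) i.castSucc * D i) (c T) else 0) +
        if i = T.min then Fin.partialProd (residue L D) T.min.castSucc (c T) else 0 := by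
    rcases lt_trichotomy i T.min with hi | rfl | hi
    · rw [koszulTerm_koszulHtpy_of_forall_lt L D c T fun j hj => hi.trans_le (T.min_le hj),
        h.partialProd_koszulTerm_eraseMin_of_lt c T hi, if_pos hi, if_neg hi.ne]
    · rw [koszulTerm, dif_pos T.min_mem, h.partialProd_koszulTerm_eraseMin_min,
        if_neg (lt_irrefl _), if_pos rfl]
    · rw [h.koszulTerm_koszulHtpy_add_of_min_lt c T hi, if_neg hi.not_gt, if_neg hi.ne', add_zero]
  have htel := LinearMap.congr_fun (h.sum_mul_partialProd_residue_mul T.min.castSucc) (c T)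
  simp only [Fin.castSucc_lt_castSucc_iff, LinearMap.sum_apply] at htel
  rw [Pi.add_apply, koszulHtpy_apply, koszulMap_eq_sum_koszulTerm, koszulMap_eq_sum_koszulTerm,
    map_sum, map_sum, ← Finset.sum_add_distrib]
  simp only [hterm]
  rw [Finset.sum_add_distrib, ← Finset.sum_filter, htel, Finset.sum_ite_eq' Finset.univ,
    if_pos (Finset.mem_univ _)]
  exact sub_add_cancel _ _

end CompatibleLeftInverses

variable {W : Type*} [AddCommGroup W] [Module R W]

lemma partialProd_natural {E : Fin n → Module.End R V} {E' : Fin n → Module.End R W}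
    {g : V →ₗ[R] W} (h : ∀ i v, E' i (g v) = g (E i v)) (k : Fin (n + 1)) (v : V) :
    Fin.partialProd E' k (g v) = g (Fin.partialProd E k v) := by
  induction k using Fin.induction generalizing v with
  | zero => simp
  | succ j ih => simp [Fin.partialProd_succ, h, ih]

lemma koszulHtpy_natural {L D : Fin n → Module.End R V} {L' D' : Fin n → Module.End R W}
    {g : V →ₗ[R] W} (hL : ∀ i v, L' i (g v) = g (L i v)) (hD : ∀ i v, D' i (g v) = g (D i v))
    {p : ℕ} (c : KIdx n p → V) (S : KIdx n (p + 1)) :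
    koszulHtpy L' D' p (fun T => g (c T)) S = g (koszulHtpy L D p c S) := by
  rw [koszulHtpy_apply, koszulHtpy_apply, hD]
  exact partialProd_natural (fun i v => by simp [residue, hL, hD]) _ _

end

/-! ### Division of polynomials by `uᵢ - tᵢ` -/

section

variable {σ R V : Type*} [CommRing R] [AddCommGroup V] [Module R V]

/-- Multiplication by `uᵢ` on the polynomials `V[uᵢ : i ∈ σ]`. -/
def varMul (i : σ) : Module.End R ((σ →₀ ℕ) →₀ V) :=
  Finsupp.lmapDomain V R (Finsupp.single i 1 + ·)

/-- The operator `uᵢ - tᵢ` on the polynomials `V[uᵢ : i ∈ σ]`. -/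
def varSub (t : σ → Module.End R V) (i : σ) : Module.End R ((σ →₀ ℕ) →₀ V) :=
  varMul i - Finsupp.mapRange.linearMap (t i)

/-- The quotient of the division by `uᵢ - tᵢ`, that is, the map
`p(u) ↦ (p(u) - p(u₁, …, u_{i-1}, tᵢ, u_{i+1}, …, uₙ)) / (uᵢ - tᵢ)`, where
`(uᵏ - tᵏ) / (u - t) = ∑ₐ uᵃ tᵏ⁻¹⁻ᵃ`. -/
def divVarSub (t : σ → Module.End R V) (i : σ) : Module.End R ((σ →₀ ℕ) →₀ V) :=
  Finsupp.lsum R fun k => ∑ a ∈ Finset.range (k i),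
    Finsupp.lsingle (k.update i a) ∘ₗ (t i ^ (k i - 1 - a))

lemma mapRange_linearMap_single {W : Type*} [AddCommGroup W] [Module R W] (g : V →ₗ[R] W)
    (k : σ →₀ ℕ) (v : V) :
    Finsupp.mapRange.linearMap g (.single k v : (σ →₀ ℕ) →₀ V) = .single k (g v) :=
  Finsupp.mapRange_single (hf := g.map_zero)

lemma varMul_single (i : σ) (k : σ →₀ ℕ) (v : V) :
    varMul (R := R) i (.single k v) = .single (Finsupp.single i 1 + k) v :=
  Finsupp.mapDomain_single

lemma varSub_single (t : σ → Module.End R V) (i : σ) (k : σ →₀ ℕ) (v : V) :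
    varSub t i (.single k v) = .single (Finsupp.single i 1 + k) v - .single k (t i v) := by
  rw [varSub, LinearMap.sub_apply, varMul_single, mapRange_linearMap_single]

lemma divVarSub_single (t : σ → Module.End R V) (i : σ) (k : σ →₀ ℕ) (v : V) :
    divVarSub t i (.single k v) = ∑ a ∈ Finset.range (k i),
      .single (k.update i a) ((t i ^ (k i - 1 - a)) v) := by
  simp [divVarSub]

lemma divVarSub_single_zero (t : σ → Module.End R V) (i : σ) (v : V) :
    divVarSub t i (.single 0 v) = 0 := by
  rw [divVarSub_single, Finsupp.coe_zero, Pi.zero_apply, Finset.range_zero, Finset.sum_empty]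

lemma update_single_add_self (i : σ) (k : σ →₀ ℕ) (a : ℕ) :
    (Finsupp.single i 1 + k).update i a = k.update i a := by
  classical
  ext j
  by_cases h : j = i
  · subst h; simp
  · simp [Finsupp.single_eq_of_ne h, Function.update_of_ne h]

lemma update_single_add_of_ne {i j : σ} (h : i ≠ j) (k : σ →₀ ℕ) (a : ℕ) :
    (Finsupp.single i 1 + k).update j a = Finsupp.single i 1 + k.update j a := by
  classical
  ext l
  by_cases h' : l = j
  · subst h'; simp [Finsupp.single_eq_of_ne h.symm]
  · simp [Function.update_of_ne h']

lemma commute_varMul (i j : σ) : Commute (varMul i) (varMul (R := R) (V := V) j) :=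
  Finsupp.lhom_ext fun k v => by
    simp only [Module.End.mul_apply, varMul_single, add_left_comm]

lemma commute_varMul_mapRange (i : σ) (g : Module.End R V) :
    Commute (varMul i) (Finsupp.mapRange.linearMap g) :=
  Finsupp.lhom_ext fun k v => by
    simp only [Module.End.mul_apply, varMul_single, mapRange_linearMap_single]

lemma divVarSub_mul_varMul_self (t : σ → Module.End R V) (i : σ) :
    divVarSub t i * varMul i = 1 + divVarSub t i * Finsupp.mapRange.linearMap (t i) :=
  Finsupp.lhom_ext fun k v => by
    have hk : (Finsupp.single i 1 + k : σ →₀ ℕ) i = k i + 1 := by simp [add_comm]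
    simp only [Module.End.mul_apply, LinearMap.add_apply, Module.End.one_apply, varMul_single,
      mapRange_linearMap_single, divVarSub_single, hk, Finset.sum_range_succ,
      update_single_add_self, Finsupp.update_self, Nat.add_sub_cancel, Nat.sub_self, pow_zero]
    rw [add_comm]
    congr 1
    refine Finset.sum_congr rfl fun a ha => ?_
    have hka : k i - a = k i - 1 - a + 1 := by have := Finset.mem_range.1 ha; omega
    rw [hka, pow_succ, Module.End.mul_apply]

lemma commute_varMul_divVarSub (t : σ → Module.End R V) {i j : σ} (h : i ≠ j) :
    Commute (varMul i) (divVarSub t j) :=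
  Finsupp.lhom_ext fun k v => by
    have hk : (Finsupp.single i 1 + k : σ →₀ ℕ) j = k j := by
      simp [Finsupp.single_eq_of_ne h.symm]
    simp only [Module.End.mul_apply, divVarSub_single, varMul_single, map_sum, hk,
      update_single_add_of_ne h]

section

variable {W : Type*} [AddCommGroup W] [Module R W] {t : σ → Module.End R V}
  {t' : σ → Module.End R W} {g : V →ₗ[R] W}

lemma varSub_natural {i : σ} (h : ∀ v, t' i (g v) = g (t i v)) (f : (σ →₀ ℕ) →₀ V) :
    varSub t' i (Finsupp.mapRange.linearMap g f) = Finsupp.mapRange.linearMap g (varSub t i f) := by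
  refine LinearMap.congr_fun (f := varSub t' i ∘ₗ Finsupp.mapRange.linearMap g)
    (g := Finsupp.mapRange.linearMap g ∘ₗ varSub t i) (Finsupp.lhom_ext fun k v => ?_) f
  simp only [LinearMap.comp_apply, varSub_single, map_sub, mapRange_linearMap_single, h]

lemma divVarSub_natural {i : σ} (h : ∀ v, t' i (g v) = g (t i v)) (f : (σ →₀ ℕ) →₀ V) :
    divVarSub t' i (Finsupp.mapRange.linearMap g f) =
      Finsupp.mapRange.linearMap g (divVarSub t i f) := by
  have hpow (m : ℕ) (v : V) : (t' i ^ m) (g v) = g ((t i ^ m) v) := by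
    rw [Module.End.pow_apply, Module.End.pow_apply]
    exact (Function.Semiconj.iterate_right (fun v => (h v).symm) m v).symm
  refine LinearMap.congr_fun (f := divVarSub t' i ∘ₗ Finsupp.mapRange.linearMap g)
    (g := Finsupp.mapRange.linearMap g ∘ₗ divVarSub t i) (Finsupp.lhom_ext fun k v => ?_) f
  simp only [LinearMap.comp_apply, divVarSub_single, map_sum, mapRange_linearMap_single, hpow]

end

lemma commute_mapRange {f g : Module.End R V} (h : Commute f g) :
    Commute (Finsupp.mapRange.linearMap f : Module.End R ((σ →₀ ℕ) →₀ V))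
      (Finsupp.mapRange.linearMap g) :=
  Finsupp.lhom_ext fun k v => by
    have hv : f (g v) = g (f v) := LinearMap.congr_fun h.eq v
    simp only [Module.End.mul_apply, mapRange_linearMap_single, hv]

lemma commute_varSub {t : σ → Module.End R V} {i j : σ} (h : Commute (t i) (t j)) :
    Commute (varSub t i) (varSub t j) := by
  have hleft : Commute (varMul i) (varSub t j) :=
    Commute.sub_right (commute_varMul i j) (commute_varMul_mapRange i (t j))
  have hright : Commute (Finsupp.mapRange.linearMap (t i)) (varSub t j) :=
    Commute.sub_right (commute_varMul_mapRange j (t i)).symm (commute_mapRange h)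
  exact Commute.sub_left hleft hright

lemma commute_varSub_divVarSub {t : σ → Module.End R V} {i j : σ} (hij : i ≠ j)
    (h : Commute (t i) (t j)) : Commute (varSub t i) (divVarSub t j) := by
  have hmapRange : Commute (Finsupp.mapRange.linearMap (t i)) (divVarSub t j) :=
    LinearMap.ext fun f => (divVarSub_natural (LinearMap.congr_fun h.eq.symm) f).symm
  exact Commute.sub_left (commute_varMul_divVarSub t hij) hmapRange

lemma compatibleLeftInverses_varSub {t : σ → Module.End R V} (ht : ∀ i j, Commute (t i) (t j)) :
    CompatibleLeftInverses (varSub t) (divVarSub t) where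
  commute i j := commute_varSub (ht i j)
  mul_eq_one i := by rw [varSub, mul_sub, divVarSub_mul_varMul_self, add_sub_cancel_right]
  commute_of_ne hij := commute_varSub_divVarSub hij (ht _ _)

/-- Modulo the images of all `uᵢ - tᵢ`, every polynomial is congruent to a constant. -/
lemma linearMap_ext_of_comp_varSub_eq_zero {W : Type*} [AddCommGroup W] [Module R W]
    {t : σ → Module.End R V} {F G : ((σ →₀ ℕ) →₀ V) →ₗ[R] W} (hF : ∀ i, F ∘ₗ varSub t i = 0)
    (hG : ∀ i, G ∘ₗ varSub t i = 0) (h : ∀ v, F (.single 0 v) = G (.single 0 v)) : F = G := by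
  have hstep {H : ((σ →₀ ℕ) →₀ V) →ₗ[R] W} (hH : ∀ i, H ∘ₗ varSub t i = 0) (i : σ)
      (k : σ →₀ ℕ) (v : V) : H (.single (Finsupp.single i 1 + k) v) = H (.single k (t i v)) := by
    have := LinearMap.congr_fun (hH i) (.single k v)
    rwa [LinearMap.comp_apply, varSub_single, map_sub, LinearMap.zero_apply, sub_eq_zero] at this
  have hadd (k : σ →₀ ℕ) : ∀ l : σ →₀ ℕ, (∀ v, F (.single l v) = G (.single l v)) →
      ∀ v, F (.single (k + l) v) = G (.single (k + l) v) := by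
    induction k using Finsupp.induction_linear with
    | zero => simp
    | add k k' hk hk' => intro l hl; rw [add_assoc]; exact hk _ (hk' _ hl)
    | single i m =>
      induction m with
      | zero => simp
      | succ m ih =>
        intro l hl v
        rw [add_comm m, Finsupp.single_add, add_assoc, hstep hF, hstep hG, ih l hl]
  exact Finsupp.lhom_ext fun k v => by simpa using hadd k 0 h v

lemma partialProd_residue_varSub_last {n : ℕ} {t : Fin n → Module.End R V}
    (ht : ∀ i j, Commute (t i) (t j)) {ev : ((Fin n →₀ ℕ) →₀ V) →ₗ[R] V}
    (hev : ∀ i f, ev (varSub t i f) = 0) (hev₀ : ∀ v, ev (.single 0 v) = v)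
    (f : (Fin n →₀ ℕ) →₀ V) :
    Fin.partialProd (residue (varSub t) (divVarSub t)) (Fin.last n) f = .single 0 (ev f) := by
  have hconst (k : Fin (n + 1)) (v : V) :
      Fin.partialProd (residue (varSub t) (divVarSub t)) k (.single 0 v) = .single 0 v := by
    induction k using Fin.induction with
    | zero => simp
    | succ j ih =>
      rw [Fin.partialProd_succ, Module.End.mul_apply, residue, LinearMap.sub_apply,
        Module.End.mul_apply, divVarSub_single_zero, map_zero, Module.End.one_apply, sub_zero, ih]
  refine LinearMap.congr_fun (g := Finsupp.lsingle 0 ∘ₗ ev)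
    (linearMap_ext_of_comp_varSub_eq_zero (t := t)
      (fun i => (compatibleLeftInverses_varSub ht).partialProd_residue_mul (Fin.castSucc_lt_last i))
      (fun i => LinearMap.ext fun f => ?_) fun v => ?_) f
  · simp [hev]
  · simp [hev₀, hconst]

end

/-! ### Modules over monoids in `𝓕` -/

section

variable {R : Type w} [CommRing R] {X : Type u} [Category.{v} X] [Preadditive X] [Linear R X]

/-- The inclusion `F → F[t_s, s ∈ σ]` of the constant polynomials. -/
def LinFun.polyConst (F : LinFun R X) (σ : Type) : F ⟶ F.poly σ :=
  LinFun.homMk (fun x => (Finsupp.lsingle 0 : F.val x →ₗ[R] ((σ →₀ ℕ) →₀ F.val x)))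
    (fun f a => (F.poly_act_single σ f 0 a).symm)

variable [MonoidalCategory X]

/-- The inclusion `A → A[t_s, s ∈ σ]` of the constant polynomials, as a morphism of monoids. -/
def FMonoid.const (A : FMonoid R X) (σ : Type) : A.Hom (A.poly σ) where
  hom := A.toFun.polyConst σ
  map_mul {x y} a b := by
    have h := polyMul_single σ (A.mul x y) 0 0 a b
    rw [add_zero] at h
    exact h.symm
  map_one := rfl

/-- Restriction of scalars along a morphism of monoids. -/
abbrev FMod.restrict {B C : FMonoid R X} (r : B.Hom C) (K : FMod C) : FMod B where
  toFun := K.toFun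
  smul x y := K.smul x y ∘ₗ LinFun.comp r.hom x
  smul_natural f g b m := by simp [LinFun.comp_act, K.smul_natural]
  mul_smul a b m := by simp [r.map_mul, K.mul_smul]
  one_smul m := by simp [r.map_one, K.one_smul]

/-- The `A[t_s, s ∈ σ]`-module `N[t_s, s ∈ σ]`. -/
abbrev FMod.poly {A : FMonoid R X} (N : FMod A) (σ : Type) : FMod (A.poly σ) where
  toFun := N.toFun.poly σ
  smul x y := polyMul σ (N.smul x y)
  smul_natural {x x' y y'} f g p q := by
    induction p using poly_induction with
    | h_zero => simp only [map_zero, LinearMap.zero_apply]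
    | h_add s t hs ht => simp only [map_add, LinearMap.add_apply, hs, ht]
    | h_single i a =>
    induction q using poly_induction with
    | h_zero => simp only [map_zero]
    | h_add s t hs ht => simp only [map_add, hs, ht]
    | h_single j b =>
    rw [LinFun.poly_act_single, LinFun.poly_act_single, polyMul_single, polyMul_single,
      LinFun.poly_act_single, N.smul_natural]
  mul_smul {x y z} p q r := by
    induction p using poly_induction with
    | h_zero => simp only [map_zero, LinearMap.zero_apply]
    | h_add s t hs ht => simp only [map_add, LinearMap.add_apply, hs, ht]
    | h_single i a =>
    induction q using poly_induction with
    | h_zero => simp only [map_zero, LinearMap.zero_apply]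
    | h_add s t hs ht => simp only [map_add, LinearMap.add_apply, hs, ht]
    | h_single j b =>
    induction r using poly_induction with
    | h_zero => simp only [map_zero]
    | h_add s t hs ht => simp only [map_add, hs, ht]
    | h_single k c =>
    rw [polyMul_single, polyMul_single, polyMul_single, polyMul_single, LinFun.poly_act_single,
      N.mul_smul, add_assoc]
  one_smul {x} p := by
    induction p using poly_induction with
    | h_zero => simp only [map_zero]
    | h_add s t hs ht => simp only [map_add, hs, ht]
    | h_single i a => rw [polyMul_single, LinFun.poly_act_single, N.one_smul, zero_add]

end

section

variable {R : Type w} [CommRing R] {X : Type u} [Category.{v} X] [Preadditive X] [Linear R X]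
  [MonoidalCategory X] {A : FMonoid R X}

namespace FMod

lemma comp_apply {K M N : FMod A} (φ : K ⟶ M) (ψ : M ⟶ N) (x : X) (k : K.toFun.val x) :
    LinFun.comp (φ ≫ ψ).1 x k = LinFun.comp ψ.1 x (LinFun.comp φ.1 x k) := rfl

lemma smul_one_left (M : FMod A) {y : X} (m : M.toFun.val y) :
    M.smul (𝟙_ X) y A.one m = M.toFun.act (λ_ y).inv m := by
  conv_rhs => rw [← M.one_smul m]
  rw [← LinFun.act_comp, Iso.hom_inv_id, LinFun.act_id]

/-- The power `N^ι`. -/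
abbrev pi (ι : Type) (N : FMod A) : FMod A where
  toFun := LinFun.of (fun x => ι → N.toFun.val x)
    (fun {x y} =>
      { toFun := fun f => LinearMap.pi fun S => N.toFun.act f ∘ₗ LinearMap.proj S
        map_add' := fun f g => by ext; simp [LinFun.act_add]
        map_smul' := fun r f => by ext; simp [LinFun.act_smul] })
    (fun x c => by ext; simp)
    (fun f g c => by ext; simp [LinFun.act_comp])
  smul x y := piMul ι (N.smul x y)
  smul_natural f g a c := by
    funext S
    exact N.smul_natural f g a (c S)
  mul_smul a b c := by
    funext S
    exact N.mul_smul a b (c S)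
  one_smul c := by
    funext S
    exact N.one_smul (c S)

section

variable {ι : Type}

/-- The projections of `N^ι`. -/
def piProj (N : FMod A) (s : ι) : pi ι N ⟶ N :=
  ⟨LinFun.homMk (fun _ => LinearMap.proj s) (fun _ _ => rfl), fun _ _ _ _ => rfl⟩

/-- The morphism to `N^ι` with given components. -/
def piLift {L N : FMod A} (φ : ι → (L ⟶ N)) : L ⟶ pi ι N :=
  ⟨LinFun.homMk (fun x => LinearMap.pi fun s => LinFun.comp (φ s).1 x)
    (fun f a => funext fun s => LinFun.comp_act (φ s).1 f a),
    fun x y a m => funext fun s => (φ s).2 x y a m⟩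

lemma piLift_proj {L N : FMod A} (φ : ι → (L ⟶ N)) (s : ι) : piLift φ ≫ piProj N s = φ s :=
  rfl

lemma pi_hom_ext {L N : FMod A} {φ ψ : L ⟶ pi ι N}
    (h : ∀ s, φ ≫ piProj N s = ψ ≫ piProj N s) : φ = ψ :=
  hom_ext fun x a => funext fun s => congrArg (fun χ : L ⟶ N => LinFun.comp χ.1 x a) (h s)

open Classical in
/-- The inclusions of `N^ι`. -/
def piIncl (N : FMod A) (s : ι) : N ⟶ pi ι N := piLift (Pi.single s (𝟙 N))

lemma sum_proj_incl [Fintype ι] (N : FMod A) :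
    ∑ s : ι, piProj N s ≫ piIncl N s = 𝟙 (pi ι N) := by
  classical
  refine pi_hom_ext fun t => ?_
  simp only [Preadditive.sum_comp, Category.assoc, Category.id_comp, piIncl, piLift_proj]
  rw [Finset.sum_eq_single t (fun s _ h => by rw [Pi.single_eq_of_ne' h, Limits.comp_zero])
    (by simp), Pi.single_eq_same, Category.comp_id]

end

/-- The map `M(x) → M(x)`, `m ↦ M(λ_x)(a × m)`, for `a ∈ A(𝟙)`. -/
def leftMul (M : FMod A) (a : A.toFun.val (𝟙_ X)) (x : X) : M.toFun.val x →ₗ[R] M.toFun.val x :=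
  M.toFun.act (λ_ x).hom ∘ₗ M.smul (𝟙_ X) x a

lemma leftMul_apply (M : FMod A) (a : A.toFun.val (𝟙_ X)) (x : X) (m : M.toFun.val x) :
    M.leftMul a x m = M.toFun.act (λ_ x).hom (M.smul (𝟙_ X) x a m) := rfl

lemma leftMul_act (M : FMod A) (a : A.toFun.val (𝟙_ X)) {x y : X} (f : x ⟶ y)
    (m : M.toFun.val x) : M.leftMul a y (M.toFun.act f m) = M.toFun.act f (M.leftMul a x m) := by
  have := M.smul_natural (𝟙 (𝟙_ X)) f a m
  rw [LinFun.act_id] at this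
  rw [leftMul_apply, leftMul_apply, this, ← LinFun.act_comp, ← LinFun.act_comp]
  simp

lemma leftMul_smul (M : FMod A) (a : A.toFun.val (𝟙_ X)) {x y : X}
    (b : A.toFun.val x) (m : M.toFun.val y) :
    M.leftMul a (x ⊗ y) (M.smul x y b m) = M.smul x y (A.leftMul a x b) m := by
  have h := M.smul_natural (λ_ x).hom (𝟙 y) (A.mul _ _ a b) m
  rw [LinFun.act_id] at h
  rw [leftMul_apply, FMonoid.leftMul_apply, h, ← M.mul_smul, ← LinFun.act_comp]
  simp

lemma smul_leftMul [BraidedCategory X] [A.IsComm] (M : FMod A)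
    (a : A.toFun.val (𝟙_ X)) {x y : X} (b : A.toFun.val x) (m : M.toFun.val y) :
    M.smul x y b (M.leftMul a y m) = M.leftMul a (x ⊗ y) (M.smul x y b m) := by
  have h := M.smul_natural (𝟙 x) (λ_ y).hom b (M.smul _ _ a m)
  have h' := M.smul_natural (ρ_ x).hom (𝟙 y) (A.mul _ _ b a) m
  rw [LinFun.act_id] at h h'
  rw [leftMul_smul, leftMul_apply, h, ← M.mul_smul, ← LinFun.act_comp, FMonoid.leftMul_apply,
    ← FMonoid.IsComm.comm b a, ← LinFun.act_comp, braiding_leftUnitor, h']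
  simp

lemma commute_leftMul [BraidedCategory X] [A.IsComm] (M : FMod A) (a b : A.toFun.val (𝟙_ X))
    (x : X) : Commute (M.leftMul a x : Module.End R (M.toFun.val x)) (M.leftMul b x) :=
  LinearMap.ext fun m => by
    rw [Module.End.mul_apply, leftMul_apply M b, leftMul_act, ← smul_leftMul]
    rfl

lemma comp_leftMul {M N : FMod A} (φ : M ⟶ N) (a : A.toFun.val (𝟙_ X)) {x : X}
    (m : M.toFun.val x) :
    LinFun.comp φ.1 x (M.leftMul a x m) = N.leftMul a x (LinFun.comp φ.1 x m) := by
  rw [leftMul_apply, leftMul_apply, LinFun.comp_act, φ.2]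

end FMod

section

variable {σ : Type}

/-- The monomial `tᵏ`, an element of `A[t_s, s ∈ σ](𝟙)`. -/
def FMonoid.mono (A : FMonoid R X) (k : σ →₀ ℕ) : (A.poly σ).toFun.val (𝟙_ X) :=
  (Finsupp.single k A.one : (σ →₀ ℕ) →₀ A.toFun.val (𝟙_ X))

lemma FMod.poly_leftMul_mono (N : FMod A) (k l : σ →₀ ℕ) (x : X)
    (m : N.toFun.val x) :
    (N.poly σ).leftMul (A.mono k) x (Finsupp.single l m : (σ →₀ ℕ) →₀ N.toFun.val x) =
      (Finsupp.single (k + l) m : (σ →₀ ℕ) →₀ N.toFun.val x) := by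
  have h := polyMul_single σ (N.smul (𝟙_ X) x) k l A.one m
  exact (congrArg ((N.toFun.poly σ).act (λ_ x).hom) h).trans
    (by rw [LinFun.poly_act_single, N.one_smul])

lemma FMonoid.leftMul_mono (A : FMonoid R X) (k l : σ →₀ ℕ) (x : X)
    (a : A.toFun.val x) :
    (A.poly σ).leftMul (A.mono k) x (Finsupp.single l a : (σ →₀ ℕ) →₀ A.toFun.val x) =
      (Finsupp.single (k + l) a : (σ →₀ ℕ) →₀ A.toFun.val x) :=
  FMod.poly_leftMul_mono A.self k l x a

namespace FMod

lemma leftMul_mono_zero (M : FMod (A.poly σ)) {x : X} (m : M.toFun.val x) :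
    M.leftMul (A.mono 0) x m = m :=
  M.one_smul m

lemma poly_hom_ext {N : FMod A} {L : FMod (A.poly σ)} {φ ψ : N.poly σ ⟶ L}
    (h : ∀ (x : X) (m : N.toFun.val x),
      LinFun.comp φ.1 x (Finsupp.single 0 m : (σ →₀ ℕ) →₀ N.toFun.val x) =
        LinFun.comp ψ.1 x (Finsupp.single 0 m : (σ →₀ ℕ) →₀ N.toFun.val x)) : φ = ψ := by
  refine hom_ext fun x p => ?_
  induction p using poly_induction with
  | h_zero => simp only [map_zero]
  | h_add s t hs ht => simp only [map_add, hs, ht]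
  | h_single k m =>
    have hk := N.poly_leftMul_mono k 0 x m
    rw [add_zero] at hk
    rw [← hk, comp_leftMul, comp_leftMul, h]

/-- The map `N(x)[t] → L(x)`, `m tᵏ ↦ tᵏ φ(m)`, for a morphism `φ : N → L` of `𝓕`. -/
def polyLiftApp {N : FMod A} {L : FMod (A.poly σ)} (φ : N.toFun ⟶ L.toFun) (x : X) :
    ((σ →₀ ℕ) →₀ N.toFun.val x) →ₗ[R] L.toFun.val x :=
  Finsupp.lsum R fun k => L.leftMul (A.mono k) x ∘ₗ LinFun.comp φ x

lemma polyLiftApp_single {N : FMod A} {L : FMod (A.poly σ)} (φ : N.toFun ⟶ L.toFun) (x : X)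
    (k : σ →₀ ℕ) (m : N.toFun.val x) :
    polyLiftApp φ x (.single k m) = L.leftMul (A.mono k) x (LinFun.comp φ x m) :=
  Finsupp.lsum_single ..

lemma polyLiftApp_act {N : FMod A} {L : FMod (A.poly σ)} (φ : N.toFun ⟶ L.toFun) {x y : X}
    (f : x ⟶ y) (p : (N.poly σ).toFun.val x) :
    polyLiftApp φ y ((N.poly σ).toFun.act f p) = L.toFun.act f (polyLiftApp φ x p) := by
  induction p using poly_induction with
  | h_zero => simp only [map_zero]
  | h_add s t hs ht => simp only [map_add, hs, ht]
  | h_single k m =>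
    rw [LinFun.poly_act_single, polyLiftApp_single, polyLiftApp_single, LinFun.comp_act,
      leftMul_act]

variable [BraidedCategory X] [A.IsComm]

lemma polyLiftApp_smul {N : FMod A} {L : FMod (A.poly σ)} (φ : N ⟶ L.restrict (A.const σ))
    {x y : X} (b : (A.poly σ).toFun.val x) (p : (N.poly σ).toFun.val y) :
    polyLiftApp (L := L) φ.1 (x ⊗ y) ((N.poly σ).smul x y b p) =
      L.smul x y b (polyLiftApp (L := L) φ.1 y p) := by
  induction p using poly_induction with
  | h_zero => simp only [map_zero]
  | h_add s t hs ht => simp only [map_add, hs, ht]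
  | h_single k m =>
  induction b using poly_induction with
  | h_zero => simp only [map_zero, LinearMap.zero_apply]
  | h_add s t hs ht => simp only [map_add, LinearMap.add_apply, hs, ht]
  | h_single i a =>
    have hφ : LinFun.comp φ.1 (x ⊗ y) (N.smul x y a m) = L.smul x y
        (Finsupp.single 0 a : (σ →₀ ℕ) →₀ A.toFun.val x) (LinFun.comp φ.1 y m) := φ.2 x y a m
    rw [polyMul_single, polyLiftApp_single, polyLiftApp_single, hφ, leftMul_smul,
      FMonoid.leftMul_mono, smul_leftMul, leftMul_smul, FMonoid.leftMul_mono, add_zero, add_comm]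

/-- The morphism of `A[t]`-modules `N[t] → L` extending a morphism of `A`-modules `N → L`. -/
def polyLift {N : FMod A} {L : FMod (A.poly σ)} (φ : N ⟶ L.restrict (A.const σ)) :
    N.poly σ ⟶ L :=
  ⟨LinFun.homMk (polyLiftApp (L := L) φ.1) (polyLiftApp_act (L := L) φ.1),
    fun _ _ => polyLiftApp_smul φ⟩

lemma polyLift_single {N : FMod A} {L : FMod (A.poly σ)} (φ : N ⟶ L.restrict (A.const σ)) (x : X)
    (k : σ →₀ ℕ) (m : N.toFun.val x) :
    LinFun.comp (polyLift φ).1 x (Finsupp.single k m : (σ →₀ ℕ) →₀ N.toFun.val x) =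
      L.leftMul (A.mono k) x (LinFun.comp φ.1 x m) :=
  polyLiftApp_single (L := L) φ.1 x k m

end FMod

end

end

/-! ### Modules over tensor idempotent monoids -/

section

variable {R : Type w} [CommRing R] {X : Type u} [Category.{v} X] [Preadditive X] [Linear R X]
  [MonoidalCategory X] [MonoidalPreadditive X] [MonoidalLinear R X] [EssentiallySmall.{w} X]
  {A : FMonoid R X}

/-- The map `(A ⊗ A)(z) → N(z ⊗ y)`, `[f, a, b] ↦ N(f ⊗ y)(a · φ(b · m))`. -/
def FMod.sandwich {M N : FMod A} (φ : M.toFun ⟶ N.toFun) {y : X} (m : M.toFun.val y) (z : X) :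
    DayVal A.toFun A.toFun z →ₗ[R] N.toFun.val (z ⊗ y) :=
  DayVal.lift
    (fun x₁ x₂ => N.toFun.actMul ((N.smul x₁ (x₂ ⊗ y)).compl₂
        (LinFun.comp φ (x₂ ⊗ y) ∘ₗ (M.smul x₂ y).flip m)) ∘ₗ
      { toFun := fun f => (α_ x₁ x₂ y).inv ≫ f ▷ y
        map_add' := fun f g => by simp
        map_smul' := fun r f => by simp })
    (fun x x' y₁ y₁' p q f a b => by
      have h := M.smul_natural q (𝟙 y) b m
      have h' := N.smul_natural p (q ⊗ₘ 𝟙 y) a (LinFun.comp φ _ (M.smul y₁ y b m))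
      rw [LinFun.act_id] at h
      simp only [LinearMap.comp_apply, LinearMap.coe_mk, AddHom.coe_mk, LinFun.actMul_apply,
        LinearMap.compl₂_apply, LinearMap.flip_apply]
      rw [h, LinFun.comp_act, h', ← LinFun.act_comp]
      congr 2
      simp [MonoidalCategory.tensorHom_def])

lemma FMod.sandwich_mk {M N : FMod A} (φ : M.toFun ⟶ N.toFun) {y : X} (m : M.toFun.val y)
    {x₁ x₂ z : X} (f : x₁ ⊗ x₂ ⟶ z) (a : A.toFun.val x₁) (b : A.toFun.val x₂) :
    FMod.sandwich φ m z (DayVal.mk _ _ x₁ x₂ z f a b) = N.toFun.act ((α_ x₁ x₂ y).inv ≫ f ▷ y)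
      (N.smul x₁ (x₂ ⊗ y) a (LinFun.comp φ (x₂ ⊗ y) (M.smul x₂ y b m))) := by
  rw [sandwich, DayVal.lift_mk]
  rfl

lemma FMod.sandwich_rightUnitor {M N : FMod A} (φ : M.toFun ⟶ N.toFun) {x y : X}
    (a : A.toFun.val x) (m : M.toFun.val y) :
    FMod.sandwich φ m x (DayVal.mk _ _ x (𝟙_ X) x (ρ_ x).hom a A.one) =
      N.smul x y a (LinFun.comp φ y m) := by
  have hnat := N.smul_natural (𝟙 x) (λ_ y).inv a (LinFun.comp φ y m)
  rw [LinFun.act_id] at hnat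
  have hid : (𝟙 x ⊗ₘ (λ_ y).inv) ≫ (α_ x (𝟙_ X) y).inv ≫ (ρ_ x).hom ▷ y = 𝟙 _ := by simp
  rw [sandwich_mk, smul_one_left, LinFun.comp_act, hnat, ← LinFun.act_comp, hid, LinFun.act_id]

lemma FMod.sandwich_leftUnitor {M N : FMod A} (φ : M.toFun ⟶ N.toFun) {x y : X}
    (a : A.toFun.val x) (m : M.toFun.val y) :
    FMod.sandwich φ m x (DayVal.mk _ _ (𝟙_ X) x x (λ_ x).hom A.one a) =
      LinFun.comp φ (x ⊗ y) (M.smul x y a m) := by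
  have hunit : (α_ (𝟙_ X) x y).inv ≫ (λ_ x).hom ▷ y = (λ_ (x ⊗ y)).hom := by simp
  rw [sandwich_mk, hunit, N.one_smul]

end

section

variable {R : Type w} [CommRing R] {X : Type u} [Category.{v} X] [Preadditive X] [Linear R X]
  [MonoidalCategory X] [EssentiallySmall.{w} X] {A : FMonoid R X}

namespace FMonoid.IsTensorIdempotent

lemma mulVal_injective (hA : A.IsTensorIdempotent) (x : X) : Function.Injective (A.mulVal x) := by
  have : IsIso A.mulHom := hA
  exact Function.LeftInverse.injective (g := LinFun.comp (inv A.mulHom) x) fun t =>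
    congrArg (fun φ => LinFun.comp φ x t) (IsIso.hom_inv_id A.mulHom)

lemma mk_one_right (hA : A.IsTensorIdempotent) {x : X} (a : A.toFun.val x) :
    DayVal.mk A.toFun A.toFun x (𝟙_ X) x (ρ_ x).hom a A.one =
      DayVal.mk A.toFun A.toFun (𝟙_ X) x x (λ_ x).hom A.one a :=
  hA.mulVal_injective x (by rw [A.mulVal_mk, A.mulVal_mk, A.mul_one, A.one_mul])

variable [MonoidalPreadditive X] [MonoidalLinear R X]

/-- Since `a ⊗ 1 = 1 ⊗ a` in `A ⊗ A`, the expression `b φ(c m)`, which only depends on the image of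
`b ⊗ c` in `A ⊗ A`, takes the same value at `a ⊗ 1` and at `1 ⊗ a`. -/
lemma mem_homs (hA : A.IsTensorIdempotent) {M N : FMod A} (φ : M.toFun ⟶ N.toFun) :
    φ ∈ FMod.homs M N := fun x y a m => by
  rw [← FMod.sandwich_leftUnitor, ← FMod.sandwich_rightUnitor, hA.mk_one_right]

end FMonoid.IsTensorIdempotent

end

section

variable {R : Type w} [CommRing R] {X : Type u} [Category.{v} X] [Preadditive X] [Linear R X]
  [MonoidalCategory X] [MonoidalPreadditive X] [MonoidalLinear R X] [EssentiallySmall.{w} X]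
  [BraidedCategory X] {A : FMonoid R X} [A.IsComm]

lemma FMonoid.IsTensorIdempotent.relProjective_poly (hA : A.IsTensorIdempotent) (N : FMod A)
    (σ : Type) : RelProjective (FMod.forget (A.poly σ)) (N.poly σ) := by
  intro L N' g hg f
  obtain ⟨⟨s, hs⟩⟩ := hg.exists_splitEpi
  let ψ : N.toFun ⟶ (L.restrict (A.const σ)).toFun := N.toFun.polyConst σ ≫ f.1 ≫ s
  refine ⟨FMod.polyLift (L := L) ⟨ψ, hA.mem_homs ψ⟩, FMod.poly_hom_ext fun x m => ?_⟩
  rw [FMod.comp_apply, FMod.polyLift_single, FMod.leftMul_mono_zero]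
  exact congrArg (fun χ => LinFun.comp χ x (LinFun.comp f.1 x
    (Finsupp.single 0 m : (σ →₀ ℕ) →₀ N.toFun.val x))) hs

end

section

variable {𝒞 𝒟 : Type*} [Category 𝒞] [Preadditive 𝒞] [Category 𝒟]

lemma RelProjective.of_sum_eq_id {U : 𝒞 ⥤ 𝒟} {P Q : 𝒞} (hQ : RelProjective U Q) {ι : Type*}
    [Fintype ι] (π : ι → (P ⟶ Q)) (j : ι → (Q ⟶ P)) (h : ∑ s, π s ≫ j s = 𝟙 P) :
    RelProjective U P := by
  intro L N g hg f
  choose l hl using fun s => hQ g hg (j s ≫ f)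
  refine ⟨∑ s, π s ≫ l s, ?_⟩
  calc (∑ s, π s ≫ l s) ≫ g = (∑ s, π s ≫ j s) ≫ f := by
        simp only [Preadditive.sum_comp, Category.assoc, hl]
    _ = f := by rw [h, Category.id_comp]

end

/-! ### Exactness and isomorphisms of modules are detected pointwise -/

section

open Limits ZeroObject

lemma exact_of_epi_of_mono {𝒞 : Type*} [Category 𝒞] [HasZeroMorphisms 𝒞] [HasZeroObject 𝒞]
    {S : ShortComplex 𝒞} {K Q : 𝒞} {i : K ⟶ S.X₂} {wi : i ≫ S.g = 0}
    (hi : IsLimit (KernelFork.ofι i wi)) {p : S.X₂ ⟶ Q} {wp : S.f ≫ p = 0}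
    (hp : IsColimit (CokernelCofork.ofπ p wp)) (f' : S.X₁ ⟶ K) [Epi f'] (hf' : f' ≫ i = S.f)
    (g' : Q ⟶ S.X₃) [Mono g'] (hg' : p ≫ g' = S.g) : S.Exact := by
  have hlift : hi.lift (KernelFork.ofι S.f S.zero) = f' :=
    Fork.IsLimit.hom_ext hi ((hi.fac _ WalkingParallelPair.zero).trans hf'.symm)
  have hdesc : hp.desc (CokernelCofork.ofπ S.g S.zero) = g' :=
    Cofork.IsColimit.hom_ext hp ((hp.fac _ WalkingParallelPair.one).trans hg'.symm)
  have hip : i ≫ p = 0 := by rw [← cancel_mono g', Category.assoc, hg', wi, zero_comp]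
  let left : S.LeftHomologyData :=
    { K, H := 0, i, π := 0, wi, hi
      wπ := comp_zero
      hπ := CokernelCofork.IsColimit.ofπ _ _ (fun _ _ => 0)
        (fun k hk => by rw [hlift] at hk; rw [comp_zero, ← cancel_epi f', hk, comp_zero])
        (fun _ _ _ _ => (isZero_zero 𝒞).eq_of_src _ _) }
  let right : S.RightHomologyData :=
    { Q, H := 0, p, ι := 0, wp, hp
      wι := zero_comp
      hι := KernelFork.IsLimit.ofι _ _ (fun _ _ => 0)
        (fun k hk => by rw [hdesc] at hk; rw [zero_comp, ← cancel_mono g', hk, zero_comp])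
        (fun _ _ _ _ => (isZero_zero 𝒞).eq_of_tgt _ _) }
  exact ⟨⟨{ left, right, iso := Iso.refl _, comm := by simp [left, right, hip] }, isZero_zero 𝒞⟩⟩

end

namespace FMod

variable {R : Type w} [CommRing R] {X : Type u} [Category.{v} X] [Preadditive X] [Linear R X]
  [MonoidalCategory X] {A : FMonoid R X}

/-- The submodule of `M` given by stable submodules of the `M(x)`. -/
abbrev sub (M : FMod A) (V : ∀ x, Submodule R (M.toFun.val x))
    (hact : ∀ {x y : X} (f : x ⟶ y), ∀ m ∈ V x, M.toFun.act f m ∈ V y)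
    (hsmul : ∀ {x y : X} (a : A.toFun.val x), ∀ m ∈ V y, M.smul x y a m ∈ V (x ⊗ y)) :
    FMod A where
  toFun := LinFun.of (fun x => V x)
    (fun {x y} =>
      { toFun := fun f => (M.toFun.act f).restrict (hact f)
        map_add' := fun f g => by
          ext m
          exact LinearMap.congr_fun (M.toFun.act_add f g) m.1
        map_smul' := fun r f => by
          ext m
          exact LinearMap.congr_fun (M.toFun.act_smul r f) m.1 })
    (fun x m => Subtype.ext (M.toFun.act_id x m.1))
    (fun f g m => Subtype.ext (M.toFun.act_comp f g m.1))
  smul x y := LinearMap.mk₂ R (fun a m => ⟨M.smul x y a m.1, hsmul a m.1 m.2⟩)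
    (fun a a' m => Subtype.ext (LinearMap.map_add₂ (M.smul x y) a a' m.1))
    (fun r a m => Subtype.ext (LinearMap.map_smul₂ (M.smul x y) r a m.1))
    (fun a m m' => Subtype.ext (map_add (M.smul x y a) m.1 m'.1))
    (fun r a m => Subtype.ext (map_smul (M.smul x y a) r m.1))
  smul_natural f g a m := Subtype.ext (M.smul_natural f g a m.1)
  mul_smul a b m := Subtype.ext (M.mul_smul a b m.1)
  one_smul m := Subtype.ext (M.one_smul m.1)

/-- The kernel of a morphism of modules. -/
abbrev ker {M N : FMod A} (φ : M ⟶ N) : FMod A :=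
  M.sub (fun x => LinearMap.ker (LinFun.comp φ.1 x))
    (fun f m hm => by
      rw [LinearMap.mem_ker] at hm ⊢
      rw [LinFun.comp_act, hm, map_zero])
    (fun a m hm => by
      rw [LinearMap.mem_ker] at hm ⊢
      rw [φ.2, hm, map_zero])

/-- The image of a morphism of modules. -/
abbrev range {M N : FMod A} (φ : M ⟶ N) : FMod A :=
  N.sub (fun x => LinearMap.range (LinFun.comp φ.1 x))
    (fun f _ ⟨k, hk⟩ => ⟨M.toFun.act f k, by rw [LinFun.comp_act, hk]⟩)
    (fun a _ ⟨k, hk⟩ => ⟨M.smul _ _ a k, by rw [φ.2, hk]⟩)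

/-- The inclusion of the kernel. -/
def kerι {M N : FMod A} (φ : M ⟶ N) : ker φ ⟶ M :=
  ⟨LinFun.homMk (fun _ => Submodule.subtype _) (fun _ _ => rfl), fun _ _ _ _ => rfl⟩

/-- The inclusion of the image. -/
def rangeι {M N : FMod A} (φ : M ⟶ N) : range φ ⟶ N :=
  ⟨LinFun.homMk (fun _ => Submodule.subtype _) (fun _ _ => rfl), fun _ _ _ _ => rfl⟩

/-- The corestriction of a morphism to its image. -/
def toRange {M N : FMod A} (φ : M ⟶ N) : M ⟶ range φ :=
  ⟨LinFun.homMk (fun x => (LinFun.comp φ.1 x).rangeRestrict)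
    (fun f m => Subtype.ext (LinFun.comp_act φ.1 f m)), fun x y a m => Subtype.ext (φ.2 x y a m)⟩

lemma congr_apply {M N : FMod A} {φ ψ : M ⟶ N} (h : φ = ψ) (x : X) (m : M.toFun.val x) :
    LinFun.comp φ.1 x m = LinFun.comp ψ.1 x m := by rw [h]

lemma mono_of_injective {M N : FMod A} (φ : M ⟶ N)
    (h : ∀ x, Function.Injective (LinFun.comp φ.1 x)) : Mono φ where
  right_cancellation _ _ hg := hom_ext fun x m => h x (congr_apply hg x m)

lemma epi_of_surjective {M N : FMod A} (φ : M ⟶ N)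
    (h : ∀ x, Function.Surjective (LinFun.comp φ.1 x)) : Epi φ where
  left_cancellation _ _ hg := hom_ext fun x => (h x).forall.2 (congr_apply hg x)

/-- The factorization through the kernel. -/
def kerLift {M N P : FMod A} (φ : M ⟶ N) (ψ : P ⟶ M) (h : ψ ≫ φ = 0) : P ⟶ ker φ :=
  ⟨LinFun.homMk (fun x => (LinFun.comp ψ.1 x).codRestrict _ (congr_apply h x))
    (fun f m => Subtype.ext (LinFun.comp_act ψ.1 f m)), fun x y a m => Subtype.ext (ψ.2 x y a m)⟩

lemma kerι_comp {M N : FMod A} (φ : M ⟶ N) : kerι φ ≫ φ = 0 := hom_ext fun _ m => m.2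

/-- `FMod.ker` is a kernel. -/
def isLimitKerι {M N : FMod A} (φ : M ⟶ N) :
    Limits.IsLimit (Limits.KernelFork.ofι (kerι φ) (kerι_comp φ)) :=
  have := mono_of_injective (kerι φ) fun _ => Subtype.val_injective
  Limits.KernelFork.IsLimit.ofι' _ _ fun ψ hψ => ⟨kerLift φ ψ hψ, rfl⟩

section

variable {M N P : FMod A} (φ : M ⟶ N) (hφ : ∀ x, Function.Surjective (LinFun.comp φ.1 x))
  (ψ : M ⟶ P) (h : ∀ x m, LinFun.comp φ.1 x m = 0 → LinFun.comp ψ.1 x m = 0)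

/-- The value at `x` of the factorization of `ψ` through a pointwise surjective morphism `φ`. -/
def descApp (x : X) : N.toFun.val x →ₗ[R] P.toFun.val x :=
  (LinearMap.ker (LinFun.comp φ.1 x)).liftQ (LinFun.comp ψ.1 x) (h x) ∘ₗ
    ((LinFun.comp φ.1 x).quotKerEquivOfSurjective (hφ x)).symm.toLinearMap

lemma descApp_apply (x : X) (m : M.toFun.val x) :
    descApp φ hφ ψ h x (LinFun.comp φ.1 x m) = LinFun.comp ψ.1 x m := by
  rw [descApp, LinearMap.comp_apply, ← LinearMap.quotKerEquivOfSurjective_apply_mk _ (hφ x),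
    LinearEquiv.coe_coe, LinearEquiv.symm_apply_apply]
  rfl

/-- The factorization of `ψ` through a pointwise surjective morphism `φ`. -/
def desc : N ⟶ P :=
  ⟨LinFun.homMk (descApp φ hφ ψ h) (fun {x y} f n => by
      obtain ⟨m, rfl⟩ := hφ x n
      rw [← LinFun.comp_act, descApp_apply, descApp_apply, LinFun.comp_act]),
    fun x y a n => by
      obtain ⟨m, rfl⟩ := hφ y n
      rw [LinFun.comp_homMk, LinFun.comp_homMk, ← φ.2, descApp_apply, descApp_apply, ψ.2]⟩

lemma comp_desc : φ ≫ desc φ hφ ψ h = ψ := hom_ext (descApp_apply φ hφ ψ h)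

end

/-- A pointwise surjective morphism is a cokernel. -/
def isColimitOfSurjective {L M N : FMod A} {ψ : L ⟶ M} {φ : M ⟶ N} (w : ψ ≫ φ = 0)
    (hφ : ∀ x, Function.Surjective (LinFun.comp φ.1 x))
    (h : ∀ x m, LinFun.comp φ.1 x m = 0 → ∃ l, LinFun.comp ψ.1 x l = m) :
    Limits.IsColimit (Limits.CokernelCofork.ofπ φ w) :=
  have := epi_of_surjective φ hφ
  Limits.CokernelCofork.IsColimit.ofπ' _ _ fun χ hχ =>
    ⟨desc φ hφ χ fun x m hm => by
      obtain ⟨l, rfl⟩ := h x m hm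
      exact congr_apply hχ x l, comp_desc φ hφ χ _⟩

lemma isZero_pi {ι : Type} [IsEmpty ι] (N : FMod A) : Limits.IsZero (pi ι N) := by
  rw [Limits.IsZero.iff_id_eq_zero]
  exact pi_hom_ext fun s => isEmptyElim s

lemma exact_of_pointwise (S : ShortComplex (FMod A))
    (h : ∀ (x : X) (m : S.X₂.toFun.val x), LinFun.comp S.g.1 x m = 0 →
      ∃ k, LinFun.comp S.f.1 x k = m) : S.Exact := by
  have : Limits.HasZeroObject (FMod A) := ⟨_, isZero_pi (ι := PEmpty) A.self⟩
  have : Mono (rangeι S.g) := mono_of_injective _ fun _ => Subtype.val_injective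
  have : Epi (kerLift S.g S.f S.zero) := epi_of_surjective _ fun x m =>
    (h x m.1 m.2).imp fun _ => Subtype.ext
  have hp := isColimitOfSurjective (ψ := S.f) (φ := toRange S.g)
    (hom_ext fun x m => Subtype.ext (congr_apply S.zero x m))
    (fun x => (LinFun.comp S.g.1 x).surjective_rangeRestrict)
    (fun x m hm => h x m (congrArg Subtype.val hm))
  exact exact_of_epi_of_mono (isLimitKerι S.g) hp (kerLift S.g S.f S.zero) rfl (rangeι S.g) rfl

lemma isIso_of_bijective {M N : FMod A} (φ : M ⟶ N)
    (h : ∀ x, Function.Bijective (LinFun.comp φ.1 x)) : IsIso φ := by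
  have : Epi φ := epi_of_surjective φ fun x => (h x).surjective
  let ψ : N ⟶ M := desc φ (fun x => (h x).surjective) (𝟙 M) fun x m hm =>
    (h x).injective (hm.trans (map_zero _).symm)
  have hψ : φ ≫ ψ = 𝟙 M := comp_desc ..
  exact ⟨ψ, hψ, by rw [← cancel_epi φ, reassoc_of% hψ, Category.comp_id]⟩

end FMod

/-! ### Contractible chain complexes -/

section

variable {𝒟 : Type*} [Category 𝒟] [Preadditive 𝒟] {K : ChainComplex 𝒟 ℕ}

/-- The homotopy from the identity to zero given by maps `sᵢ : Kᵢ → Kᵢ₊₁` with `s d + d s = 1`. -/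
def contractingHomotopy (s : ∀ i, K.X i ⟶ K.X (i + 1)) (h₀ : s 0 ≫ K.d 1 0 = 𝟙 _)
    (h : ∀ i, K.d (i + 1) i ≫ s i + s (i + 1) ≫ K.d (i + 2) (i + 1) = 𝟙 _) :
    Homotopy (𝟙 K) 0 where
  hom i j := if hij : i + 1 = j then s i ≫ eqToHom (congrArg K.X hij) else 0
  zero i j hij := dif_neg hij
  comm i := by
    cases i with
    | zero =>
      rw [Homotopy.dNext_zero_chainComplex, Homotopy.prevD_chainComplex]
      simp [h₀]
    | succ i =>
      rw [Homotopy.dNext_succ_chainComplex, Homotopy.prevD_chainComplex]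
      simp [h]

lemma id_eq_of_homotopy (H : Homotopy (𝟙 K) 0) (i : ℕ) :
    𝟙 (K.X (i + 1)) =
      K.d (i + 1) i ≫ H.hom i (i + 1) + H.hom (i + 1) (i + 2) ≫ K.d (i + 2) (i + 1) := by
  have h := H.comm (i + 1)
  rw [Homotopy.dNext_succ_chainComplex, Homotopy.prevD_chainComplex] at h
  exact h.trans (add_zero _)

lemma id_zero_eq_of_homotopy (H : Homotopy (𝟙 K) 0) : 𝟙 (K.X 0) = H.hom 0 1 ≫ K.d 1 0 := by
  have h := H.comm 0
  rw [Homotopy.dNext_zero_chainComplex, Homotopy.prevD_chainComplex, zero_add] at h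
  exact h.trans (add_zero _)

lemma isSplitComplex_of_homotopy (H : Homotopy (𝟙 K) 0) : IsSplitComplex K := by
  refine ⟨fun i => H.hom i (i + 1), fun i => ?_⟩
  cases i with
  | zero => rw [← id_zero_eq_of_homotopy, Category.comp_id]
  | succ i =>
    have h := congrArg (K.d (i + 2) (i + 1) ≫ ·) (id_eq_of_homotopy H i)
    rw [Category.comp_id, Preadditive.comp_add, K.d_comp_d_assoc, Limits.zero_comp, zero_add] at h
    exact h.symm

end

lemma FMod.acyclic_of_homotopy {R : Type w} [CommRing R] {X : Type u} [Category.{v} X]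
    [Preadditive X] [Linear R X] [MonoidalCategory X] {A : FMonoid R X}
    {K : ChainComplex (FMod A) ℕ}
    (H : Homotopy (𝟙 (((FMod.forget A).mapHomologicalComplex _).obj K)) 0) : K.Acyclic := by
  intro i
  cases i with
  | zero =>
    rw [K.exactAt_iff' 1 0 0 (by simp) (by simp)]
    exact FMod.exact_of_pointwise _ fun x m _ => ⟨LinFun.comp (H.hom 0 1) x m,
      congrArg (fun χ => LinFun.comp χ x m) (id_zero_eq_of_homotopy H).symm⟩
  | succ i =>
    rw [K.exactAt_iff' (i + 2) (i + 1) i (by simp) (by simp)]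
    refine FMod.exact_of_pointwise _ fun x m hm => ⟨LinFun.comp (H.hom (i + 1) (i + 2)) x m, ?_⟩
    have hsum := congrArg (fun χ => LinFun.comp χ x m) (id_eq_of_homotopy H i)
    refine (hsum.trans ((congrArg (· + _) ?_).trans (zero_add _))).symm
    exact (congrArg (LinFun.comp (H.hom i (i + 1)) x) hm).trans (map_zero _)

/-! ### Koszul complexes of endomorphisms of a module -/

lemma KIdx.isEmpty_of_lt {n p : ℕ} (h : n < p) : IsEmpty (KIdx n p) :=
  ⟨fun S => h.not_ge ((S.2.symm.trans_le (Finset.card_le_univ S.1)).trans_eq (Fintype.card_fin n))⟩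

instance {n : ℕ} : Unique (KIdx n 0) where
  default := ⟨∅, rfl⟩
  uniq S := Subtype.ext (Finset.card_eq_zero.1 S.2)

namespace FMod

section

variable {R : Type w} [CommRing R] {X : Type u} [Category.{v} X] [Preadditive X] [Linear R X]
  [MonoidalCategory X] {A : FMonoid R X} {N : FMod A} {n : ℕ}

/-- The differential of the Koszul complex of endomorphisms `ℓ₁, …, ℓₙ` of a module. -/
def koszulHom (ℓ : Fin n → (N ⟶ N)) (p : ℕ) : pi (KIdx n (p + 1)) N ⟶ pi (KIdx n p) N :=
  piLift fun T => ∑ i : {i // i ∉ T.1}, koszulSign T.1 i.1 • (piProj N (T.insert i) ≫ ℓ i.1)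

lemma koszulHom_apply (ℓ : Fin n → (N ⟶ N)) (p : ℕ) (x : X)
    (c : KIdx n (p + 1) → N.toFun.val x) :
    LinFun.comp (koszulHom ℓ p).1 x c = koszulMap (fun i => LinFun.comp (ℓ i).1 x) p c := by
  let evalAt : (pi (KIdx n (p + 1)) N ⟶ N) →+ N.toFun.val x :=
    { toFun := fun φ => LinFun.comp φ.1 x c
      map_zero' := rfl
      map_add' := fun _ _ => rfl }
  funext T
  refine (map_sum evalAt _ _).trans (Eq.trans ?_ (koszulMap_apply _ p c T).symm)
  exact Finset.sum_congr rfl fun i _ => map_zsmul evalAt _ _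

lemma koszulHom_zero_proj_comp {ℓ : Fin n → (N ⟶ N)} {M : FMod A} {ε : N ⟶ M}
    (h : ∀ i, ℓ i ≫ ε = 0) : koszulHom ℓ 0 ≫ piProj N default ≫ ε = 0 := by
  rw [koszulHom, ← Category.assoc, piLift_proj, Preadditive.sum_comp]
  exact Finset.sum_eq_zero fun i _ => by
    rw [Preadditive.zsmul_comp, Category.assoc, h, Limits.comp_zero, smul_zero]

/-- The Koszul complex of commuting endomorphisms `ℓ₁, …, ℓₙ` of a module. -/
def koszul (ℓ : Fin n → (N ⟶ N)) (hℓ : ∀ i j, ℓ i ≫ ℓ j = ℓ j ≫ ℓ i) : ChainComplex (FMod A) ℕ :=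
  ChainComplex.of (fun p => pi (KIdx n p) N) (koszulHom ℓ) fun p => hom_ext fun x c => by
    rw [comp_apply, koszulHom_apply, koszulHom_apply]
    exact koszulMap_comp _ (fun i j => congr_apply (hℓ j i) x) p c

lemma koszul_d (ℓ : Fin n → (N ⟶ N)) (hℓ : ∀ i j, ℓ i ≫ ℓ j = ℓ j ≫ ℓ i) (p : ℕ) :
    (koszul ℓ hℓ).d (p + 1) p = koszulHom ℓ p :=
  ChainComplex.of_d (fun p => pi (KIdx n p) N) (koszulHom ℓ) p

end

section

variable {R : Type w} [CommRing R] {X : Type u} [Category.{v} X] [Preadditive X] [Linear R X]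
  [MonoidalCategory X] {A B : FMonoid R X} (F : FMod A ⥤ FMod B) [F.Additive]
  {N : FMod A} {P : FMod B}

section

variable {ι : Type}

lemma sum_map_proj_map_incl [Fintype ι] :
    ∑ s, F.map (piProj N s) ≫ F.map (piIncl N s) = 𝟙 (F.obj (pi ι N)) := by
  simp only [← F.map_comp, ← F.map_sum, sum_proj_incl, F.map_id]

lemma map_pi_hom_ext [Finite ι] {L : FMod B} {φ ψ : L ⟶ F.obj (pi ι N)}
    (h : ∀ s, φ ≫ F.map (piProj N s) = ψ ≫ F.map (piProj N s)) : φ = ψ := by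
  cases nonempty_fintype ι
  rw [← Category.comp_id φ, ← Category.comp_id ψ, ← sum_map_proj_map_incl]
  simp only [Preadditive.comp_sum, reassoc_of% h]

/-- The isomorphism `P^ι ≅ F(N^ι)`, for an additive functor `F` and an isomorphism `P ≅ F(N)`. -/
def mapPiIso (ι : Type) [Fintype ι] (e : P ≅ F.obj N) : pi ι P ≅ F.obj (pi ι N) where
  hom := ∑ s, piProj P s ≫ e.hom ≫ F.map (piIncl N s)
  inv := piLift fun s => F.map (piProj N s) ≫ e.inv
  hom_inv_id := pi_hom_ext fun t => by
    classical
    rw [Category.assoc, piLift_proj, ← Category.assoc, Iso.comp_inv_eq, Preadditive.sum_comp,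
      Category.id_comp, Finset.sum_eq_single t _ (by simp)]
    · rw [Category.assoc, Category.assoc, ← F.map_comp, piIncl, piLift_proj, Pi.single_eq_same,
        F.map_id, Category.comp_id]
    · intro s _ hst
      rw [Category.assoc, Category.assoc, ← F.map_comp, piIncl, piLift_proj,
        Pi.single_eq_of_ne' hst, F.map_zero, Limits.comp_zero, Limits.comp_zero]
  inv_hom_id := by
    rw [Preadditive.comp_sum, ← sum_map_proj_map_incl]
    refine Finset.sum_congr rfl fun s _ => ?_
    rw [← Category.assoc, piLift_proj, Category.assoc, Iso.inv_hom_id_assoc]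

lemma mapPiIso_hom_proj [Fintype ι] (e : P ≅ F.obj N) (s : ι) :
    (mapPiIso F ι e).hom ≫ F.map (piProj N s) = piProj P s ≫ e.hom := by
  rw [← Iso.eq_inv_comp, ← Category.assoc, ← Iso.comp_inv_eq]
  rfl

end

lemma koszulHom_mapPiIso {n : ℕ} (e : P ≅ F.obj N) (ℓ : Fin n → (N ⟶ N)) (ℓ' : Fin n → (P ⟶ P))
    (h : ∀ i, ℓ' i ≫ e.hom = e.hom ≫ F.map (ℓ i)) (p : ℕ) :
    koszulHom ℓ' p ≫ (mapPiIso F (KIdx n p) e).hom =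
      (mapPiIso F (KIdx n (p + 1)) e).hom ≫ F.map (koszulHom ℓ p) := by
  refine map_pi_hom_ext F fun T => ?_
  rw [Category.assoc, Category.assoc, mapPiIso_hom_proj, ← F.map_comp, koszulHom, koszulHom,
    piLift_proj, ← Category.assoc, piLift_proj]
  simp only [F.map_sum, F.map_zsmul, F.map_comp, Preadditive.comp_sum, Preadditive.sum_comp,
    Preadditive.comp_zsmul, Preadditive.zsmul_comp, Category.assoc, h,
    reassoc_of% mapPiIso_hom_proj F e]

end

end FMod

section

variable {R : Type w} [CommRing R] {X : Type u} [Category.{v} X] [Preadditive X] [Linear R X]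
  [MonoidalCategory X] [BraidedCategory X] (C : FMonoid R X) [C.IsComm]

/-- The multiplication by an element of `C(𝟙)`, as an endomorphism of the module `C`. -/
def FMonoid.leftMulHom (a : C.toFun.val (𝟙_ X)) : C.self ⟶ C.self :=
  ⟨LinFun.homMk (C.leftMul a) (C.leftMul_act a), fun _ _ b c => (C.mul_leftMul a b c).symm⟩

lemma koszulD_eq_koszulHom {n : ℕ} (α : Fin n → C.toFun.val (𝟙_ X)) (p : ℕ) :
    koszulD C α p = FMod.koszulHom (fun i => C.leftMulHom (α i)) p :=
  FMod.hom_ext fun x c => (FMod.koszulHom_apply (fun i => C.leftMulHom (α i)) p x c).symm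

end

/-! ### The isomorphism between `M[u]` and `A[u, v] ⊗_{A[t]} M` -/

section

variable {α β : Type*}

/-- The exponents of the first group of variables. -/
def uExp : (α ⊕ β →₀ ℕ) →+ (α →₀ ℕ) := Finsupp.comapDomain.addMonoidHom Sum.inl_injective

/-- The exponents of the second group of variables. -/
def vExp : (α ⊕ β →₀ ℕ) →+ (β →₀ ℕ) := Finsupp.comapDomain.addMonoidHom Sum.inr_injective

lemma uExp_inl (k : α →₀ ℕ) : uExp (k.mapDomain (Sum.inl : α → α ⊕ β)) = k :=
  Finsupp.comapDomain_mapDomain _ Sum.inl_injective k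

lemma uExp_inr (k : β →₀ ℕ) : uExp (k.mapDomain (Sum.inr : β → α ⊕ β)) = 0 :=
  Finsupp.ext fun _ => Finsupp.mapDomain_of_notMem_range _ _ (by simp)

lemma vExp_inl (k : α →₀ ℕ) : vExp (k.mapDomain (Sum.inl : α → α ⊕ β)) = 0 :=
  Finsupp.ext fun _ => Finsupp.mapDomain_of_notMem_range _ _ (by simp)

lemma vExp_inr (k : β →₀ ℕ) : vExp (k.mapDomain (Sum.inr : β → α ⊕ β)) = k :=
  Finsupp.comapDomain_mapDomain _ Sum.inr_injective k

lemma mapDomain_uExp_add_mapDomain_vExp (k : α ⊕ β →₀ ℕ) :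
    (uExp k).mapDomain Sum.inl + (vExp k).mapDomain Sum.inr = k := by
  ext (i | i)
  · rw [Finsupp.add_apply, Finsupp.mapDomain_apply Sum.inl_injective,
      Finsupp.mapDomain_of_notMem_range _ _ (by simp), add_zero]
    rfl
  · rw [Finsupp.add_apply, Finsupp.mapDomain_apply Sum.inr_injective,
      Finsupp.mapDomain_of_notMem_range _ _ (by simp), zero_add]
    rfl

end

section

variable {R : Type w} [CommRing R] {X : Type u} [Category.{v} X] [Preadditive X] [Linear R X]
  [MonoidalCategory X]

lemma FMonoid.leftMul_one (C : FMonoid R X) (c : C.toFun.val (𝟙_ X)) :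
    C.leftMul c (𝟙_ X) C.one = c := by
  rw [FMonoid.leftMul_apply, unitors_equal, C.mul_one]

lemma FMonoid.rename_mono (A : FMonoid R X) {σ τ : Type} (e : σ → τ) (k : σ →₀ ℕ) :
    LinFun.comp (A.rename e).hom (𝟙_ X) (A.mono k) = A.mono (k.mapDomain e) :=
  Finsupp.mapDomain_single

lemma FMonoid.rename_const (A : FMonoid R X) {σ τ : Type} (e : σ → τ) {x : X}
    (a : A.toFun.val x) :
    LinFun.comp (A.rename e).hom x (LinFun.comp (A.const σ).hom x a) =
      LinFun.comp (A.const τ).hom x a :=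
  Finsupp.mapDomain_single

variable [BraidedCategory X] {B C : FMonoid R X}

section

variable [EssentiallySmall.{w} X] (r : B.Hom C) (M : FMod B)

/-- The map `M(z) → (C ⊗_B M)(z)`, `m ↦ c ⊗ m`, for `c ∈ C(𝟙)`. -/
def BalVal.tmul (c : C.toFun.val (𝟙_ X)) (z : X) : M.toFun.val z →ₗ[R] BalVal r C.self M z :=
  BalVal.mk r C.self M (𝟙_ X) z z (λ_ z).hom c

lemma BalVal.act_tmul (c : C.toFun.val (𝟙_ X)) {z z' : X} (g : z ⟶ z') (m : M.toFun.val z) :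
    act r C.self M z z' g (tmul r M c z m) = tmul r M c z' (M.toFun.act g m) := by
  have h := mk_dinatural (r := r) (K := C.self) (M := M) (𝟙 (𝟙_ X)) g (λ_ z').hom c m
  rw [LinFun.act_id] at h
  rw [tmul, act_mk, tmul, ← h]
  simp

lemma BalVal.tmul_sub (c c' : C.toFun.val (𝟙_ X)) {z : X} (m : M.toFun.val z) :
    tmul r M (c - c') z m = tmul r M c z m - tmul r M c' z m := by
  simp only [tmul, map_sub, LinearMap.sub_apply]

end

variable [C.IsComm]

lemma FMonoid.self_rsmul (r : B.Hom C) {x y : X} (c : C.toFun.val x) (b : B.toFun.val y) :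
    C.self.rsmul r x y c b = C.mul x y c (LinFun.comp r.hom y b) :=
  FMonoid.IsComm.comm _ _

namespace BalVal

variable [EssentiallySmall.{w} X] (r : B.Hom C) (M : FMod B)

lemma mk_leftMul_rsmul {x y z : X} (f : x ⊗ y ⟶ z) (c : C.toFun.val (𝟙_ X)) (b : B.toFun.val x)
    (m : M.toFun.val y) :
    mk r C.self M x y z f (C.leftMul c x (LinFun.comp r.hom x b)) m =
      tmul r M c z (M.toFun.act f (M.smul x y b m)) := by
  have hmk := mk_dinatural (r := r) (K := C.self) (M := M) (λ_ x).hom (𝟙 y) f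
    (C.mul (𝟙_ X) x c (LinFun.comp r.hom x b)) m
  have hbal := mk_balanced (r := r) (K := C.self) (M := M) (((λ_ x).hom ⊗ₘ 𝟙 y) ≫ f) c b m
  have hact := mk_dinatural (r := r) (K := C.self) (M := M) (𝟙 (𝟙_ X)) f (λ_ z).hom c
    (M.smul x y b m)
  have hassoc : (α_ (𝟙_ X) x y).inv ≫ ((λ_ x).hom ⊗ₘ 𝟙 y) ≫ f = (𝟙 _ ⊗ₘ f) ≫ (λ_ z).hom := by
    simp
  rw [LinFun.act_id] at hmk hact
  rw [hassoc, hact, FMonoid.self_rsmul] at hbal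
  exact hmk.symm.trans hbal

lemma mk_rsmul {x y z : X} (f : x ⊗ y ⟶ z) (b : B.toFun.val x) (m : M.toFun.val y) :
    mk r C.self M x y z f (LinFun.comp r.hom x b) m =
      tmul r M C.one z (M.toFun.act f (M.smul x y b m)) := by
  rw [← mk_leftMul_rsmul, FMonoid.leftMul_apply, C.one_mul]

lemma tmul_rsmul (b : B.toFun.val (𝟙_ X)) {z : X} (m : M.toFun.val z) :
    tmul r M (LinFun.comp r.hom (𝟙_ X) b) z m = tmul r M C.one z (M.leftMul b z m) :=
  mk_rsmul r M (λ_ z).hom b m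

end BalVal

end

section

variable {R : Type w} [CommRing R] {X : Type u} [Category.{v} X] [Preadditive X] [Linear R X]
  [MonoidalCategory X] [SymmetricCategory X] [MonoidalPreadditive X] [MonoidalLinear R X]
  [EssentiallySmall.{w} X]

namespace BalVal

variable {B C : FMonoid R X} [C.IsComm] (l r : B.Hom C) (M : FMod B)

lemma smul_tmul_one {x y : X} (b : B.toFun.val x) (m : M.toFun.val y) :
    smul l r C.self M x y b (tmul r M C.one y m) =
      mk r C.self M x y (x ⊗ y) (𝟙 _) (LinFun.comp l.hom x b) m := by
  have h := mk_dinatural (r := r) (K := C.self) (M := M) (ρ_ x).hom (𝟙 y) (𝟙 _)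
    (C.mul x (𝟙_ X) (LinFun.comp l.hom x b) C.one) m
  rw [C.mul_one, LinFun.act_id] at h
  rw [tmul, smul_mk, ← h]
  simp

lemma leftMul_tmul (b : B.toFun.val (𝟙_ X)) (c : C.toFun.val (𝟙_ X)) {z : X} (m : M.toFun.val z) :
    (balTensor l r C.self M).leftMul b z (tmul r M c z m) =
      tmul r M (C.leftMul (LinFun.comp l.hom (𝟙_ X) b) (𝟙_ X) c) z m := by
  have h := mk_dinatural (r := r) (K := C.self) (M := M) (λ_ (𝟙_ X)).hom (𝟙 z) (λ_ z).hom
    (C.mul _ _ (LinFun.comp l.hom (𝟙_ X) b) c) m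
  rw [LinFun.act_id] at h
  refine Eq.trans ?_ h
  refine (congrArg (act r C.self M _ _ (λ_ z).hom) (smul_mk l r C.self M b _ c m)).trans ?_
  rw [act_mk]
  congr 3
  simp

end BalVal

end

section

variable {R : Type w} [CommRing R] {X : Type u} [Category.{v} X] [Preadditive X] [Linear R X]
  [MonoidalCategory X] {A : FMonoid R X} {n : ℕ} (M : FMod (A.poly (Fin n)))

namespace FMod

/-- The `A[u]`-module `M[u]`, for an `A[t]`-module `M`; only the underlying `A`-module of `M` is
used. The monoids `A[u]` and `A[t]` are the same. -/
abbrev free : FMod (A.poly (Fin n)) := (M.restrict (A.const (Fin n))).poly (Fin n)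

/-- The action of `tᵢ` on `M(x)`. -/
abbrev varAct (x : X) (i : Fin n) : Module.End R (M.toFun.val x) := M.leftMul (A.var i) x

variable [BraidedCategory X] [A.IsComm]

lemma varSub_smul {x y : X} (i : Fin n) (b : (A.poly (Fin n)).toFun.val x)
    (p : (free M).toFun.val y) :
    varSub (M.varAct (x ⊗ y)) i ((free M).smul x y b p) =
      (free M).smul x y b (varSub (M.varAct y) i p) := by
  induction p using poly_induction with
  | h_zero => simp only [map_zero]
  | h_add s t hs ht => simp only [map_add, hs, ht]
  | h_single k m =>
  induction b using poly_induction with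
  | h_zero => simp only [map_zero, LinearMap.zero_apply]
  | h_add s t hs ht => simp only [map_add, LinearMap.add_apply, hs, ht]
  | h_single l b =>
    rw [polyMul_single, varSub_single, varSub_single, map_sub, polyMul_single, polyMul_single,
      LinearMap.comp_apply, M.smul_leftMul, add_left_comm]

/-- The endomorphism `uᵢ - tᵢ` of `M[u]`. -/
def freeDiff (i : Fin n) : free M ⟶ free M :=
  ⟨LinFun.homMk (fun x => varSub (M.varAct x) i) fun f p =>
    varSub_natural (M.leftMul_act (A.var i) f) p, fun _ _ => varSub_smul M i⟩

lemma freeDiff_apply (i : Fin n) (x : X) :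
    LinFun.comp (freeDiff M i).1 x = varSub (M.varAct x) i := rfl

lemma commute_varAct (x : X) (i j : Fin n) : Commute (M.varAct x i) (M.varAct x j) :=
  M.commute_leftMul (A.var i) (A.var j) x

lemma freeDiff_comm (i j : Fin n) : freeDiff M i ≫ freeDiff M j = freeDiff M j ≫ freeDiff M i :=
  hom_ext fun x p =>
    LinearMap.congr_fun (commute_varSub (M.commute_varAct x j i)).eq p

/-- The augmentation `M[u] → M`, `uᵢ ↦ tᵢ`. -/
def freeEval : free M ⟶ M := polyLift (𝟙 (M.restrict (A.const (Fin n))))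

lemma freeEval_single (x : X) (k : Fin n →₀ ℕ) (m : M.toFun.val x) :
    LinFun.comp (freeEval M).1 x (Finsupp.single k m : (Fin n →₀ ℕ) →₀ M.toFun.val x) =
      M.leftMul (A.mono k) x m :=
  polyLift_single (𝟙 (M.restrict (A.const (Fin n)))) x k m

lemma freeEval_single_zero (x : X) (m : M.toFun.val x) :
    LinFun.comp (freeEval M).1 x (Finsupp.single 0 m : (Fin n →₀ ℕ) →₀ M.toFun.val x) = m :=
  (freeEval_single M x 0 m).trans (M.leftMul_mono_zero m)

lemma freeDiff_freeEval (i : Fin n) : freeDiff M i ≫ freeEval M = 0 :=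
  poly_hom_ext fun x m => by
    rw [comp_apply, freeDiff_apply, varSub_single, map_sub, freeEval_single_zero, add_zero,
      freeEval_single]
    exact sub_self _

end FMod

end

section

variable {R : Type w} [CommRing R] {X : Type u} [Category.{v} X] [Preadditive X] [Linear R X]
  [MonoidalCategory X] {A : FMonoid R X} {n : ℕ} (M : FMod (A.poly (Fin n)))

namespace FMod

/-- The trilinear map `(f, c, m) ↦ M(f)(c · m)`, with values in `M[u](z)`, where `c ∈ A[v](x)[u]`
acts coefficientwise. -/
def polyTensorToFreeMk (x y z : X) :
    (x ⊗ y ⟶ z) →ₗ[R] ((Fin n ⊕ Fin n →₀ ℕ) →₀ A.toFun.val x) →ₗ[R] M.toFun.val y →ₗ[R]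
      ((Fin n →₀ ℕ) →₀ M.toFun.val z) where
  toFun f := Finsupp.lsum R fun k =>
    ((M.toFun.actMul (M.smul x y) f ∘ₗ
      (Finsupp.lsingle (vExp k) : A.toFun.val x →ₗ[R] ((Fin n →₀ ℕ) →₀ A.toFun.val x))).compr₂
        (Finsupp.lsingle (uExp k)))
  map_add' f g := by
    ext
    simp
  map_smul' r f := by
    ext
    simp

lemma polyTensorToFreeMk_single {x y z : X} (f : x ⊗ y ⟶ z) (k : Fin n ⊕ Fin n →₀ ℕ)
    (a : A.toFun.val x) (m : M.toFun.val y) :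
    polyTensorToFreeMk M x y z f (.single k a) m = .single (uExp k) (M.toFun.act f
      (M.smul x y (Finsupp.single (vExp k) a : (Fin n →₀ ℕ) →₀ A.toFun.val x) m)) :=
  LinearMap.congr_fun (Finsupp.lsum_single R _ k a) m

lemma polyTensorToFreeMk_dinatural {x x' y y' z : X} (p : x ⟶ x') (q : y ⟶ y') (f : x' ⊗ y' ⟶ z)
    (c : (A.poly₂ n).toFun.val x) (m : M.toFun.val y) :
    polyTensorToFreeMk M x y z ((p ⊗ₘ q) ≫ f) c m =
      polyTensorToFreeMk M x' y' z f ((A.poly₂ n).toFun.act p c) (M.toFun.act q m) := by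
  induction c using poly_induction with
  | h_zero => simp only [map_zero, LinearMap.zero_apply]
  | h_add s t hs ht => simp only [map_add, LinearMap.add_apply, hs, ht]
  | h_single k a =>
    have hm := M.smul_natural p q (Finsupp.single (vExp k) a : (Fin n →₀ ℕ) →₀ A.toFun.val x) m
    rw [LinFun.poly_act_single] at hm
    rw [LinFun.poly_act_single, polyTensorToFreeMk_single, polyTensorToFreeMk_single, hm,
      LinFun.act_comp]

section

variable [BraidedCategory X] [A.IsComm]

lemma polyTensorToFreeMk_balanced {x y y' z : X} (f : (x ⊗ y) ⊗ y' ⟶ z)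
    (c : (A.poly₂ n).toFun.val x) (b : (A.poly (Fin n)).toFun.val y) (m : M.toFun.val y') :
    polyTensorToFreeMk M (x ⊗ y) y' z f ((A.poly₂ n).self.rsmul (A.vIncl n) x y c b) m =
      polyTensorToFreeMk M x (y ⊗ y') z ((α_ x y y').inv ≫ f) c (M.smul y y' b m) := by
  rw [FMonoid.self_rsmul]
  induction c using poly_induction with
  | h_zero => simp only [map_zero, LinearMap.zero_apply]
  | h_add s t hs ht => simp only [map_add, LinearMap.add_apply, hs, ht]
  | h_single k a =>
  induction b using poly_induction with
  | h_zero => simp only [map_zero, LinearMap.zero_apply]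
  | h_add s t hs ht => simp only [map_add, LinearMap.add_apply, hs, ht]
  | h_single l b =>
    have hb : LinFun.comp (A.vIncl n).hom y (Finsupp.single l b : (Fin n →₀ ℕ) →₀ A.toFun.val y) =
        (Finsupp.single (l.mapDomain Sum.inr) b : (Fin n ⊕ Fin n →₀ ℕ) →₀ A.toFun.val y) :=
      Finsupp.mapDomain_single
    have hm := M.mul_smul (Finsupp.single (vExp k) a : (Fin n →₀ ℕ) →₀ A.toFun.val x)
      (Finsupp.single l b : (Fin n →₀ ℕ) →₀ A.toFun.val y) m
    rw [polyMul_single] at hm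
    rw [hb, polyMul_single, polyTensorToFreeMk_single, polyTensorToFreeMk_single, map_add, map_add,
      uExp_inr, vExp_inr, add_zero, ← hm, ← LinFun.act_comp, Iso.hom_inv_id_assoc]

variable [EssentiallySmall.{w} X]

/-- The map `(A[u, v] ⊗_{A[t]} M)(z) → M[u](z)`, `c ⊗ m ↦ c · m`, with `vᵢ` acting as `tᵢ`. -/
def polyTensorToFree (z : X) :
    BalVal (A.vIncl n) (A.poly₂ n).self M z →ₗ[R] ((Fin n →₀ ℕ) →₀ M.toFun.val z) :=
  BalVal.lift (fun x y => polyTensorToFreeMk M x y z)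
    (fun _ _ _ _ => polyTensorToFreeMk_dinatural M) fun _ _ _ => polyTensorToFreeMk_balanced M

lemma polyTensorToFree_tmul_inl (k : Fin n →₀ ℕ) {z : X} (m : M.toFun.val z) :
    polyTensorToFree M z (BalVal.tmul (A.vIncl n) M (A.mono (k.mapDomain Sum.inl)) z m) =
      .single k m := by
  refine (BalVal.lift_mk _ _ (fun _ _ _ => polyTensorToFreeMk_balanced M) _ _ _).trans ?_
  refine (polyTensorToFreeMk_single M _ _ A.one m).trans ?_
  rw [uExp_inl, vExp_inl]
  exact congrArg _ (M.one_smul m)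

end

variable [SymmetricCategory X] [MonoidalPreadditive X] [MonoidalLinear R X]
  [EssentiallySmall.{w} X] [A.IsComm]

/-- The `A[u]`-module `A[u, v] ⊗_{A[t]} M`. -/
abbrev polyTensor : FMod (A.poly (Fin n)) := balTensor (A.uIncl n) (A.vIncl n) (A.poly₂ n).self M

/-- The morphism of `A`-modules `M → A[u, v] ⊗_{A[t]} M`, `m ↦ 1 ⊗ m`. -/
def toPolyTensor : M.restrict (A.const (Fin n)) ⟶ (polyTensor M).restrict (A.const (Fin n)) :=
  ⟨LinFun.homMk (BalVal.tmul (A.vIncl n) M (A.poly₂ n).one)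
    fun f m => (BalVal.act_tmul (A.vIncl n) M (A.poly₂ n).one f m).symm, fun x y a m => by
      refine Eq.trans ?_ (BalVal.smul_tmul_one (A.uIncl n) (A.vIncl n) M _ m).symm
      rw [FMonoid.uIncl, FMonoid.rename_const, ← A.rename_const Sum.inr, ← FMonoid.vIncl,
        BalVal.mk_rsmul, LinFun.act_id]
      rfl⟩

/-- The morphism of `A[u]`-modules `M[u] → A[u, v] ⊗_{A[t]} M` given by `m ↦ 1 ⊗ m`. -/
def freeToPolyTensor : free M ⟶ polyTensor M := polyLift (toPolyTensor M)

lemma freeToPolyTensor_single (k : Fin n →₀ ℕ) (z : X) (m : M.toFun.val z) :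
    LinFun.comp (freeToPolyTensor M).1 z (Finsupp.single k m : (Fin n →₀ ℕ) →₀ M.toFun.val z) =
      BalVal.tmul (A.vIncl n) M (A.mono (k.mapDomain Sum.inl)) z m := by
  refine (polyLift_single (toPolyTensor M) z k m).trans ?_
  refine (BalVal.leftMul_tmul (A.uIncl n) (A.vIncl n) M (A.mono k) (A.poly₂ n).one m).trans ?_
  rw [FMonoid.leftMul_one, FMonoid.uIncl, FMonoid.rename_mono]

lemma polyTensorToFree_freeToPolyTensor (z : X) (p : (free M).toFun.val z) :
    polyTensorToFree M z (LinFun.comp (freeToPolyTensor M).1 z p) = p := by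
  induction p using poly_induction with
  | h_zero => simp only [map_zero]
  | h_add s t hs ht => simp only [map_add, hs, ht]
  | h_single k m => rw [freeToPolyTensor_single, polyTensorToFree_tmul_inl]

lemma freeToPolyTensor_surjective (z : X) :
    Function.Surjective (LinFun.comp (freeToPolyTensor M).1 z) := by
  intro t
  rw [← LinearMap.mem_range]
  induction t using BalVal.induction with
  | h_zero => exact zero_mem _
  | h_add s t hs ht => exact add_mem hs ht
  | h_mk x y f c m =>
  induction c using poly_induction with
  | h_zero =>
    rw [map_zero, LinearMap.zero_apply]
    exact zero_mem _
  | h_add s t hs ht =>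
    rw [map_add, LinearMap.add_apply]
    exact add_mem hs ht
  | h_single k a =>
    have hc : (Finsupp.single k a : (Fin n ⊕ Fin n →₀ ℕ) →₀ A.toFun.val x) =
        (A.poly₂ n).leftMul (A.mono ((uExp k).mapDomain Sum.inl)) x
          (LinFun.comp (A.vIncl n).hom x
            (Finsupp.single (vExp k) a : (Fin n →₀ ℕ) →₀ A.toFun.val x)) := by
      refine (congrArg (Finsupp.single · a) (mapDomain_uExp_add_mapDomain_vExp k).symm).trans
        ((A.leftMul_mono _ _ x a).symm.trans (congrArg _ Finsupp.mapDomain_single.symm))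
    rw [hc, BalVal.mk_leftMul_rsmul, ← freeToPolyTensor_single]
    exact ⟨_, rfl⟩

instance : IsIso (freeToPolyTensor M) :=
  isIso_of_bijective _ fun z =>
    ⟨Function.LeftInverse.injective (polyTensorToFree_freeToPolyTensor M z),
      freeToPolyTensor_surjective M z⟩

lemma freeToPolyTensor_single_zero (z : X) (m : M.toFun.val z) :
    LinFun.comp (freeToPolyTensor M).1 z (Finsupp.single 0 m : (Fin n →₀ ℕ) →₀ M.toFun.val z) =
      BalVal.tmul (A.vIncl n) M (A.poly₂ n).one z m := by
  rw [freeToPolyTensor_single, Finsupp.mapDomain_zero]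
  rfl

/-- The isomorphism `M[u] ≅ A[u, v] ⊗_{A[t]} M`. -/
def freeIsoPolyTensor : free M ≅ (balFunctor (A.uIncl n) (A.vIncl n) M).obj (A.poly₂ n).self :=
  (asIso (freeToPolyTensor M) : free M ≅ polyTensor M)

lemma freeDiff_freeIsoPolyTensor_hom (i : Fin n) :
    freeDiff M i ≫ (freeIsoPolyTensor M).hom = (freeIsoPolyTensor M).hom ≫
      (balFunctor (A.uIncl n) (A.vIncl n) M).map ((A.poly₂ n).leftMulHom (A.diff n i)) :=
  poly_hom_ext fun z m => by
    have hu : A.mono ((Finsupp.single i 1).mapDomain Sum.inl) = A.var (Sum.inl i : Fin n ⊕ Fin n) :=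
      congrArg A.mono Finsupp.mapDomain_single
    have hv : LinFun.comp (A.vIncl n).hom (𝟙_ X) (A.var i) = A.var (Sum.inr i) :=
      (A.rename_mono _ _).trans (congrArg A.mono Finsupp.mapDomain_single)
    have hdiff : LinFun.comp (freeToPolyTensor M).1 z (varSub (M.varAct z) i (Finsupp.single 0 m)) =
        BalVal.tmul (A.vIncl n) M (A.diff n i) z m := by
      rw [varSub_single, map_sub, freeToPolyTensor_single, freeToPolyTensor_single_zero, add_zero,
        ← BalVal.tmul_rsmul, hu, hv, FMonoid.diff, BalVal.tmul_sub]
    have hmap : BalVal.map (A.vIncl n) ((A.poly₂ n).leftMulHom (A.diff n i)) M z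
          (BalVal.tmul (A.vIncl n) M (A.poly₂ n).one z m) =
        BalVal.tmul (A.vIncl n) M (A.diff n i) z m :=
      (BalVal.map_mk _ _ _ _ _ _).trans
        (congrArg (BalVal.tmul (A.vIncl n) M · z m) ((A.poly₂ n).leftMul_one _))
    exact (hdiff.trans hmap.symm).trans
      (congrArg (BalVal.map _ _ M z) (freeToPolyTensor_single_zero M z m).symm)

lemma freeIsoPolyTensor_hom_balAug :
    (freeIsoPolyTensor M).hom ≫
        balAug (A.uIncl n) (A.vIncl n) (A.fold n) (A.fold_uIncl n) (A.fold_vIncl n) M =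
      freeEval M :=
  poly_hom_ext fun z m => by
    have haug : BalVal.aug (A.vIncl n) (A.fold n) (A.fold_vIncl n) M z
        (BalVal.tmul (A.vIncl n) M (A.poly₂ n).one z m) = m := by
      rw [BalVal.tmul, BalVal.aug_mk, FMonoid.Hom.map_one, M.one_smul]
    rw [freeEval_single_zero]
    exact (congrArg _ (freeToPolyTensor_single_zero M z m)).trans haug

end FMod

end

/-! ### The resolution -/

section

variable {R : Type w} [CommRing R] {X : Type u} [Category.{v} X] [Preadditive X] [Linear R X]
  [MonoidalCategory X] [BraidedCategory X] {A : FMonoid R X} [A.IsComm] {n : ℕ}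
  (M : FMod (A.poly (Fin n)))

namespace FMod

/-- The Koszul complex of `M[u]` and its endomorphisms `uᵢ - tᵢ`. -/
def freeKoszul : ChainComplex (FMod (A.poly (Fin n))) ℕ :=
  koszul (freeDiff M) (freeDiff_comm M)

lemma freeKoszul_d (p : ℕ) : (freeKoszul M).d (p + 1) p = koszulHom (freeDiff M) p :=
  koszul_d _ (freeDiff_comm M) p

lemma freeKoszul_d_apply (p : ℕ) (x : X) (c : KIdx n (p + 1) → (free M).toFun.val x) :
    LinFun.comp ((freeKoszul M).d (p + 1) p).1 x c = koszulMap (varSub (M.varAct x)) p c :=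
  (congr_apply (freeKoszul_d M p) x c).trans (koszulHom_apply (freeDiff M) p x c)

/-- The augmentation `M[u] → M`, `uᵢ ↦ tᵢ`, of the Koszul complex of `M[u]`. -/
def freeKoszulAug : (freeKoszul M).X 0 ⟶ M := piProj (free M) default ≫ freeEval M

lemma freeKoszul_d_freeKoszulAug : (freeKoszul M).d 1 0 ≫ freeKoszulAug M = 0 :=
  (congrArg (· ≫ freeKoszulAug M) (freeKoszul_d M 0)).trans
    (koszulHom_zero_proj_comp (freeDiff_freeEval M))

/-- The map `M → M[u]`, `m ↦ m`, of `𝓕`, with values in degree `0` of the Koszul complex. -/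
def freeKoszulUnit : M.toFun ⟶ ((freeKoszul M).X 0).toFun :=
  LinFun.homMk (fun x => LinearMap.pi fun _ =>
      (Finsupp.lsingle 0 : M.toFun.val x →ₗ[R] ((Fin n →₀ ℕ) →₀ M.toFun.val x)))
    fun f m => funext fun _ => LinFun.comp_act (M.toFun.polyConst (Fin n)) f m

/-- The contraction of the Koszul complex of `M[u]`, a map of `𝓕`. -/
def freeKoszulHtpy (p : ℕ) :
    ((freeKoszul M).X p).toFun ⟶ ((freeKoszul M).X (p + 1)).toFun :=
  LinFun.homMk (fun x => koszulHtpy (varSub (M.varAct x)) (divVarSub (M.varAct x)) p)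
    fun f c => funext fun S =>
      koszulHtpy_natural (fun i => varSub_natural (M.leftMul_act (A.var i) f))
        (fun i => divVarSub_natural (M.leftMul_act (A.var i) f)) c S

lemma freeKoszulUnit_freeKoszulAug : freeKoszulUnit M ≫ (freeKoszulAug M).1 = 𝟙 M.toFun :=
  LinFun.hom_ext fun x m => freeEval_single_zero M x m

lemma freeKoszulAug_freeKoszulUnit_add :
    (freeKoszulAug M).1 ≫ freeKoszulUnit M + freeKoszulHtpy M 0 ≫ ((freeKoszul M).d 1 0).1 =
      𝟙 ((freeKoszul M).X 0).toFun := by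
  refine LinFun.hom_ext fun x c => funext fun T => ?_
  obtain rfl := Unique.eq_default T
  have residue_eq := partialProd_residue_varSub_last (M.commute_varAct x)
    (fun i f => congr_apply (freeDiff_freeEval M i) x f) (freeEval_single_zero M x) (c default)
  have htpy_comp_d := (congrFun (freeKoszul_d_apply M 0 x _) default).trans
    ((compatibleLeftInverses_varSub (M.commute_varAct x)).koszulMap_koszulHtpy_zero c default)
  rw [residue_eq] at htpy_comp_d
  exact (congrArg (Finsupp.single 0 (LinFun.comp (freeEval M).1 x (c default)) + ·)
    htpy_comp_d).trans (add_sub_cancel _ _)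

lemma freeKoszul_d_freeKoszulHtpy_add (p : ℕ) :
    ((freeKoszul M).d (p + 1) p).1 ≫ freeKoszulHtpy M p +
        freeKoszulHtpy M (p + 1) ≫ ((freeKoszul M).d (p + 2) (p + 1)).1 =
      𝟙 ((freeKoszul M).X (p + 1)).toFun := by
  refine LinFun.hom_ext fun x c => ?_
  have d_htpy := freeKoszul_d_apply M (p + 1) x (LinFun.comp (freeKoszulHtpy M (p + 1)) x c)
  have htpy_d := congrArg (LinFun.comp (freeKoszulHtpy M p) x) (freeKoszul_d_apply M p x c)
  exact (add_comm _ _).trans ((congrArg₂ HAdd.hAdd d_htpy htpy_d).trans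
    ((compatibleLeftInverses_varSub (M.commute_varAct x)).koszulMap_koszulHtpy_succ c))

/-- The contraction of the augmented Koszul complex of `M[u]` as a complex in `𝓕`. -/
def freeKoszulHomotopy :
    Homotopy (𝟙 (((forget (A.poly (Fin n))).mapHomologicalComplex _).obj
      ((freeKoszul M).augment (freeKoszulAug M) (freeKoszul_d_freeKoszulAug M)))) 0 :=
  contractingHomotopy
    (fun | 0 => freeKoszulUnit M | i + 1 => freeKoszulHtpy M i)
    (freeKoszulUnit_freeKoszulAug M)
    fun
      | 0 => freeKoszulAug_freeKoszulUnit_add M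
      | i + 1 => freeKoszul_d_freeKoszulHtpy_add M i

lemma isSplitResolution_freeKoszul :
    IsSplitResolution (forget (A.poly (Fin n))) (freeKoszul M) (freeKoszulAug M)
      (freeKoszul_d_freeKoszulAug M) where
  exact := acyclic_of_homotopy (freeKoszulHomotopy M)
  split := isSplitComplex_of_homotopy (freeKoszulHomotopy M)

lemma isZero_freeKoszul_X {p : ℕ} (hp : n < p) : Limits.IsZero ((freeKoszul M).X p) :=
  have := KIdx.isEmpty_of_lt hp
  isZero_pi (ι := KIdx n p) (free M)

end FMod

end

section

variable {R : Type w} [CommRing R] {X : Type u} [Category.{v} X] [Preadditive X] [Linear R X]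
  [MonoidalCategory X] [MonoidalPreadditive X] [MonoidalLinear R X] [SymmetricCategory X]
  [EssentiallySmall.{w} X] {A : FMonoid R X} [A.IsComm] {n : ℕ} (M : FMod (A.poly (Fin n)))

namespace FMod

lemma relProjective_freeKoszul_X (hA : A.IsTensorIdempotent) (p : ℕ) :
    RelProjective (forget (A.poly (Fin n))) ((freeKoszul M).X p) :=
  .of_sum_eq_id (hA.relProjective_poly (M.restrict (A.const (Fin n))) (Fin n))
    (piProj (ι := KIdx n p) (free M)) (piIncl (free M)) (sum_proj_incl (free M))

lemma koszulTensor_d (p : ℕ) :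
    (koszulTensor A n M).d (p + 1) p = (balFunctor (A.uIncl n) (A.vIncl n) M).map
      (koszulHom (fun i => (A.poly₂ n).leftMulHom (A.diff n i)) p) := by
  rw [← koszulD_eq_koszulHom]
  exact congrArg (balFunctor (A.uIncl n) (A.vIncl n) M).map
    (ChainComplex.of_d (koszulObj (A.poly₂ n) n) (koszulD (A.poly₂ n) (A.diff n)) p)

/-- The isomorphism `M[u]^ι ≅ (C ⊗_{A[t]} M)^ι ≅ C^ι ⊗_{A[t]} M`, for `ι` the set of subsets
of `{1, …, n}` with `p` elements. -/
def freeKoszulXIso (p : ℕ) : (freeKoszul M).X p ≅ (koszulTensor A n M).X p :=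
  mapPiIso (P := free M) (N := (A.poly₂ n).self) (balFunctor (A.uIncl n) (A.vIncl n) M) (KIdx n p)
    (freeIsoPolyTensor M)

lemma freeKoszulXIso_hom_d (p : ℕ) :
    (freeKoszulXIso M (p + 1)).hom ≫ (koszulTensor A n M).d (p + 1) p =
      (freeKoszul M).d (p + 1) p ≫ (freeKoszulXIso M p).hom :=
  (congrArg ((freeKoszulXIso M (p + 1)).hom ≫ ·) (koszulTensor_d M p)).trans <|
    (koszulHom_mapPiIso _ (freeIsoPolyTensor M) _ _ (freeDiff_freeIsoPolyTensor_hom M) p).symm.trans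
      (congrArg (· ≫ (freeKoszulXIso M p).hom) (freeKoszul_d M p).symm)

/-- The Koszul complex of `M[u]` is `K_C(α) ⊗_{A[t]} M`. -/
def freeKoszulIso : freeKoszul M ≅ koszulTensor A n M :=
  HomologicalComplex.Hom.isoOfComponents (freeKoszulXIso M) fun i p hip => by
    obtain rfl : p + 1 = i := hip
    exact freeKoszulXIso_hom_d M p

lemma freeKoszulIso_hom_koszulTensorAug :
    (freeKoszulIso M).hom.f 0 ≫ koszulTensorAug A n M = freeKoszulAug M := by
  have hom_proj := mapPiIso_hom_proj (balFunctor (A.uIncl n) (A.vIncl n) M) (freeIsoPolyTensor M)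
    (default : KIdx n 0)
  refine (Category.assoc _ _ _).symm.trans ((congrArg (· ≫ balAug _ _ _ _ _ M) hom_proj).trans ?_)
  rw [Category.assoc, freeIsoPolyTensor_hom_balAug]
  rfl

end FMod

end

end

/-- **Relative Hilbert syzygy theorem.** -/
theorem proposition4p8 {R : Type w} [CommRing R] {X : Type u} [Category.{v} X] [Preadditive X]
    [Linear R X] [MonoidalCategory X] [MonoidalPreadditive X] [MonoidalLinear R X]
    [SymmetricCategory X] [EssentiallySmall.{w} X]
    (A : FMonoid R X) [A.IsComm] (hA : A.IsTensorIdempotent) (n : ℕ)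
    (M : FMod (A.poly (Fin n))) :
    ∃ (L : ChainComplex (FMod (A.poly (Fin n))) ℕ) (ε : L.X 0 ⟶ M) (hε : L.d 1 0 ≫ ε = 0),
      (∀ p, n < p → Limits.IsZero (L.X p)) ∧
      (∀ p, RelProjective (FMod.forget (A.poly (Fin n))) (L.X p)) ∧
      IsSplitResolution (FMod.forget (A.poly (Fin n))) L ε hε ∧
      ∃ e : L ≅ koszulTensor A n M, e.hom.f 0 ≫ koszulTensorAug A n M = ε := by
  let K := FMod.freeKoszul M
  have isZero_of_lt : ∀ p, n < p → Limits.IsZero (K.X p) := fun _ => FMod.isZero_freeKoszul_X M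
  have relProjective := FMod.relProjective_freeKoszul_X M hA
  have isSplitResolution := FMod.isSplitResolution_freeKoszul M
  exact ⟨K, FMod.freeKoszulAug M, FMod.freeKoszul_d_freeKoszulAug M, isZero_of_lt, relProjective,
    isSplitResolution, FMod.freeKoszulIso M, FMod.freeKoszulIso_hom_koszulTensorAug M⟩
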